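/- Let $\mathbb T$ be the unit circle, $\mathbb D$ the closed unit disc in $\mathbb C$, $A$ a finite alphabet, and let $F_a$ $(a\in A)$ be Möbius transformations with $F_a(\mathbb D)=\mathbb D$. For a finite word $v=v_0\cdots v_{n-1}$ put $F_v=F_{v_0}\circ\cdots\circ F_{v_{n-1}}$ (so $F_\lambda=\mathrm{id}$ for the empty word $\lambda$) and $V_v=\{x\in\mathbb T: |(F_v^{-1})'(x)|>1\}$. A sequence of such transformations $G_n$ represents $x\in\mathbb T$ if the images $G_n\mu$ of the uniform probability measure $\mu$ on $\mathbb T$ converge weakly-$*$ to $\delta_x$. For $w\in A^\omega$ let $\Phi(w)$ be the point represented by $(F_{w_0\cdots w_{n-1}})_{n\ge1}$, if there is one. A subshift is a closed shift-invariant subset of $A^\omega$, and $\mathcal L(\Sigma)$ is the set of all finite factors (including $\lambda$) of elements of $\Sigma$. A subshift $\Sigma$ is a Möbius number system for $\{F_a\}$ if $\Phi$ is defined on all of $\Sigma$, $\Phi(\Sigma)=\mathbb T$, and $\Phi|_\Sigma$ is continuous. An interval almost cover is a family $\mathcal W=\{W_a:a\in A\}$ of finite unions of open intervals of $\mathbb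 T$ with $\bigcup_{a}\overline{W_a}=\mathbb T$. Put $W_\lambda=\mathbb T$ and $W_u=W_{u_0}\cap F_{u_0}(W_{u_1})\cap\cdots\cap F_{u_0\cdots u_{n-2}}(W_{u_{n-1}})$ for $u=u_0\cdots u_{n-1}$, $n\ge1$. A subshift $\Sigma$ is compatible with $\mathcal W$ if $\overline{W_v}=\bigcup_{a:\,va\in\mathcal L(\Sigma)}\overline{W_{va}}$ for every $v\in\mathcal L(\Sigma)$. Put $\Sigma_{\mathcal W}=\{w\in\Sigma:\ W_{w_0\cdots w_{n-1}}\ne\emptyset \text{ for all } n\}$ and $$Q_n(\mathcal W,\Sigma)=\min\{|(F_u^{-1})'(x)|:\ u\in\mathcal L(\Sigma_{\mathcal W}),\ |u|=n,\ x\in\overline{W_u}\}.$$ **Statement.** Let $\mathcal W$ be an interval almost cover and $\Sigma$ a nonempty subshift compatible with $\mathcal W$. Suppose that at least one of the following holds: 1. there is a finite set $B$ of nonempty finite words over $A$ such that $W_b\subset V_b$ for every $b\in B$ and every $w\in\Sigma_{\mathcal W}$ has some $b\in B$ as a prefix; 2. $Q_n(\mathcal W,\Sigma)>1$ for some $n$;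 3. for some $n$, $Q_n(\mathcal W,\Sigma)=1$ and no $F_v$ with $v\in\mathcal L(\Sigma_{\mathcal W})$, $|v|=n$, is a rotation $z\mapsto e^{i\theta}z$ (the identity counts as a rotation). Then $\Sigma_{\mathcal W}$ is a Möbius number system for $\{F_a:a\in A\}$, and $\Phi([v]\cap\Sigma_{\mathcal W})=\overline{W_v}$ for every $v\in\mathcal L(\Sigma)$, where $[v]$ is the set of infinite words with prefix $v$. -/

import Mathlib

noncomputable section

open Set Filter Topology MeasureTheory Matrix
open scoped Pointwise

namespace MobiusNumber

/-! ### Disc preserving Möbius transformations -/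

/-- The closed unit disc as a subset of the Riemann sphere `ℂ ∪ {∞}`. -/
def unitDisc : Set (OnePoint ℂ) :=
  (fun z : ℂ => (z : OnePoint ℂ)) '' Metric.closedBall 0 1

/-- The group of matrices whose Möbius transformation `z ↦ (a z + b) / (c z + d)` of the Riemann
sphere maps the closed unit disc onto itself. Here `g • z` is Mathlib's action of `GL (Fin 2) ℂ`
on `OnePoint ℂ` by Möbius transformations; products of matrices are compositions. -/
def discGroup : Subgroup (GL (Fin 2) ℂ) :=
  MulAction.stabilizer (GL (Fin 2) ℂ) unitDisc

/-- The fractional linear expression `(a z + b) / (c z + d)`. -/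
def mobius (g : GL (Fin 2) ℂ) (z : ℂ) : ℂ :=
  (g 0 0 * z + g 0 1) / (g 1 0 * z + g 1 1)

lemma coe_mem_unitDisc (z : ℂ) : ((z : OnePoint ℂ) ∈ unitDisc) ↔ ‖z‖ ≤ 1 := by
  simp [unitDisc]

lemma smul_mem_unitDisc (g : discGroup) (p : OnePoint ℂ) :
    (g : GL (Fin 2) ℂ) • p ∈ unitDisc ↔ p ∈ unitDisc := by
  have hg : (g : GL (Fin 2) ℂ) • unitDisc = unitDisc := g.2
  conv_lhs => rw [← hg]
  exact Set.smul_mem_smul_set_iff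

lemma denom_ne_zero (g : discGroup) {z : ℂ} (hz : ‖z‖ ≤ 1) :
    (g : GL (Fin 2) ℂ) 1 0 * z + (g : GL (Fin 2) ℂ) 1 1 ≠ 0 := by
  intro h
  have h1 := (smul_mem_unitDisc g z).2 ((coe_mem_unitDisc z).2 hz)
  rw [OnePoint.smul_some_eq_ite, if_pos h] at h1
  simp [unitDisc] at h1

/-- Off the pole, the action on the sphere is given by the fractional linear expression. -/
lemma smul_coe (g : GL (Fin 2) ℂ) {z : ℂ} (hz : g 1 0 * z + g 1 1 ≠ 0) :
    g • (z : OnePoint ℂ) = ((mobius g z : ℂ) : OnePoint ℂ) := by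
  rw [OnePoint.smul_some_eq_ite, if_neg hz, mobius]

/-- A disc preserving transformation preserves the unit circle. -/
lemma norm_mobius (g : discGroup) (z : Circle) : ‖mobius g z‖ = 1 := by
  have hz : ‖(z : ℂ)‖ ≤ 1 := (Circle.norm_coe z).le
  have hd := denom_ne_zero g hz
  have hle : ‖mobius g z‖ ≤ 1 := by
    rw [← coe_mem_unitDisc, ← smul_coe _ hd, smul_mem_unitDisc, coe_mem_unitDisc]
    exact hz
  by_contra hne
  have hlt : ‖mobius g z‖ < 1 := lt_of_le_of_ne hle hne
  have hcont : ContinuousAt (fun t : ℝ => (g : GL (Fin 2) ℂ) 1 0 * ((1 + t : ℝ) * (z : ℂ))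
      + (g : GL (Fin 2) ℂ) 1 1) 0 := by fun_prop
  have hd0 : (g : GL (Fin 2) ℂ) 1 0 * ((1 + (0 : ℝ) : ℝ) * (z : ℂ))
      + (g : GL (Fin 2) ℂ) 1 1 ≠ 0 := by simpa using hd
  have hcont2 : ContinuousAt (fun t : ℝ => ‖mobius g ((1 + t : ℝ) * (z : ℂ))‖) 0 := by
    unfold mobius
    exact (ContinuousAt.div (by fun_prop) hcont hd0).norm
  have e1 := hcont.eventually_ne hd0
  have e2 : ∀ᶠ t in 𝓝 (0 : ℝ), ‖mobius g ((1 + t : ℝ) * (z : ℂ))‖ < 1 :=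
    hcont2.eventually_lt_const (by simpa using hlt)
  obtain ⟨t, ⟨h1, h2⟩, ht⟩ := (((e1.and e2).filter_mono nhdsWithin_le_nhds).and
    (self_mem_nhdsWithin : Ioi (0 : ℝ) ∈ 𝓝[>] (0 : ℝ))).exists
  have ht0 : (0 : ℝ) < t := ht
  have h3 := (coe_mem_unitDisc _).2 h2.le
  rw [← smul_coe _ h1, smul_mem_unitDisc, coe_mem_unitDisc, norm_mul, Circle.norm_coe, mul_one,
    Complex.norm_real, Real.norm_of_nonneg (by linarith)] at h3
  linarith

/-- The action of a disc preserving Möbius transformation on the unit circle. -/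
def onCircle (g : discGroup) (z : Circle) : Circle :=
  ⟨mobius g z, mem_sphere_zero_iff_norm.2 (norm_mobius g z)⟩

/-- The modulus of the complex derivative of the transformation at a point of the unit circle. -/
def derivModulus (g : discGroup) (x : Circle) : ℝ :=
  ‖deriv (mobius g) (x : ℂ)‖

/-- The expansion interval `V` of `F⁻¹`, for `F` the transformation given by `g`. -/
def expansionInterval (g : discGroup) : Set Circle :=
  {x | 1 < derivModulus g⁻¹ x}

/-- The transformation is a rotation `z ↦ e^{iθ} z` (the identity included). -/
def IsRotation (g : discGroup) : Prop :=
  ∃ θ : ℝ, ∀ z : ℂ, (g : GL (Fin 2) ℂ) • (z : OnePoint ℂ) =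
    ((Complex.exp (θ * Complex.I) * z : ℂ) : OnePoint ℂ)

/-! ### Representation of points -/

instance circleMeasurableSpace : MeasurableSpace Circle := borel Circle

instance circleBorelSpace : BorelSpace Circle := ⟨rfl⟩

/-- The uniform probability measure on the unit circle. -/
def uniformMeasure : Measure Circle :=
  (ENNReal.ofReal (2 * Real.pi)⁻¹ •
    (volume : Measure ℝ).restrict (Ioc 0 (2 * Real.pi))).map Circle.exp

/-- A sequence of transformations represents the point `x` if the images of the uniform measure
converge weakly-* to the Dirac measure at `x`. -/
def Represents (g : ℕ → discGroup) (x : Circle) : Prop :=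
  ∀ f : C(Circle, ℝ),
    Tendsto (fun n => ∫ z, f z ∂(uniformMeasure.map (onCircle (g n)))) atTop
      (𝓝 (∫ z, f z ∂(Measure.dirac x)))

/-! ### Words and subshifts; finite words are lists, infinite words are functions on `ℕ` -/

section Words

variable {A : Type*}

/-- The factor `w_i w_{i+1} ⋯ w_{i+n-1}` of an infinite word. -/
def factor (w : ℕ → A) (i n : ℕ) : List A :=
  List.ofFn (fun k : Fin n => w (i + k))

/-- The cylinder of all infinite words with prefix `v`. -/
def cylinder (v : List A) : Set (ℕ → A) :=
  {w | factor w 0 v.length = v}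

/-- The language of a set of infinite words: all factors of its elements. -/
def language (S : Set (ℕ → A)) : Set (List A) :=
  {v | ∃ w ∈ S, ∃ i, factor w i v.length = v}

/-- A subshift: a closed, shift invariant set of infinite words. -/
def IsSubshift [TopologicalSpace A] (S : Set (ℕ → A)) : Prop :=
  IsClosed S ∧ ∀ w ∈ S, (fun i => w (i + 1)) ∈ S

/-! ### Möbius number systems -/

/-- `F_v = F_{v_0} ∘ ⋯ ∘ F_{v_{n-1}}`. -/
def wordMap (F : A → discGroup) (v : List A) : discGroup :=
  (v.map F).prod

/-- The infinite word `w` represents the point `x`. -/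
def WordRepresents (F : A → discGroup) (w : ℕ → A) (x : Circle) : Prop :=
  Represents (fun n => wordMap F (factor w 0 n)) x

/-- The domain `𝕏_F` of the map `Φ`. -/
def phiDomain (F : A → discGroup) : Set (ℕ → A) :=
  {w | ∃ x, WordRepresents F w x}

open Classical in
/-- The map `Φ`; only its values on `phiDomain F` are meaningful. -/
def phi (F : A → discGroup) (w : ℕ → A) : Circle :=
  if h : ∃ x, WordRepresents F w x then h.choose else 1

/-- The set `S` of infinite words is a Möbius number system for the iterative system `F`. -/
def IsMobiusNumberSystem [TopologicalSpace A] (F : A → discGroup) (S : Set (ℕ → A)) : Prop :=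
  IsSubshift S ∧ S ⊆ phiDomain F ∧ phi F '' S = univ ∧ ContinuousOn (phi F) S

/-! ### Interval almost covers -/

/-- The open interval on the circle from `x` counterclockwise to `y` (for `x ≠ y`). -/
def openArc (x y : Circle) : Set Circle :=
  {z | ∃ s t : ℝ, 0 < s ∧ s < t ∧ t < 2 * Real.pi ∧
    z = x * Circle.exp s ∧ y = x * Circle.exp t}

/-- A union of finitely many open intervals. -/
def IsFiniteUnionOfArcs (U : Set Circle) : Prop :=
  ∃ P : Set (Circle × Circle), P.Finite ∧ (∀ p ∈ P, p.1 ≠ p.2) ∧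
    U = ⋃ p ∈ P, openArc p.1 p.2

/-- An interval almost cover of the circle. -/
def IsIntervalAlmostCover (W : A → Set Circle) : Prop :=
  (⋃ a, closure (W a)) = univ ∧ ∀ a, IsFiniteUnionOfArcs (W a)

/-- The refined set `W_u = W_{u_0} ∩ F_{u_0}(W_{u_1}) ∩ ⋯`, which is the whole circle for the
empty word. -/
def refined (F : A → discGroup) (W : A → Set Circle) (u : List A) : Set Circle :=
  ⋂ k : Fin u.length, onCircle (wordMap F (u.take k)) '' W (u.get k)

/-- Compatibility of a subshift with an interval almost cover. -/
def Compatible (F : A → discGroup) (W : A → Set Circle) (S : Set (ℕ → A)) : Prop :=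
  ∀ v ∈ language S,
    closure (refined F W v) =
      ⋃ a ∈ {a : A | v ++ [a] ∈ language S}, closure (refined F W (v ++ [a]))

/-- The interval shift corresponding to `S` and `W`. -/
def intervalShift (F : A → discGroup) (W : A → Set Circle) (S : Set (ℕ → A)) : Set (ℕ → A) :=
  {w ∈ S | ∀ n, (refined F W (factor w 0 n)).Nonempty}

/-- `q(u)`: the minimum of the modulus of the derivative of `F_u⁻¹` on the closure of `W_u`
(attained, since the function is continuous and the set compact, when `W_u` is nonempty). -/
def qWord (F : A → discGroup) (W : A → Set Circle) (u : List A) : ℝ :=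
  sInf (derivModulus (wordMap F u)⁻¹ '' closure (refined F W u))

/-- `Q_n`: the minimum of `q(u)` over the finitely many words `u` of length `n` in the language
of the interval shift. -/
def Qn (F : A → discGroup) (W : A → Set Circle) (S : Set (ℕ → A)) (n : ℕ) : ℝ :=
  sInf (qWord F W '' {u | u.length = n ∧ u ∈ language (intervalShift F W S)})

end Words

end MobiusNumber

end

noncomputable section

open Set Filter Topology MeasureTheory Matrix
open scoped Pointwise

namespace MobiusNumber

/-! ### The action of the disc group on the closed disc -/

/-! Everything is read off from `center g`, the image of the origin. It is the barycentre of the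
image of the uniform measure, so if `center (G n)` tends to a point x of the circle, the image
measures concentrate at x (`represents_of_tendsto_center`). The modulus of the derivative of the
inverse of g at y is the Poisson kernel `lam g y` of `center g`.

In the half-plane coordinates `cay` that send the boundary points y and g⁻¹y to infinity, g becomes
w ↦ λw + iτ with λ = `lam g y` and τ = `tau g y` (`cay_mobius`). Hence λ is multiplicative along
products and τ is an affine cocycle, and the centers of the products converge to x as soon as λ or
|τ| at x tends to infinity.

The core is `tendsto_center_of_mem_closure`. Let the factors come from a finite set and let x be a
limit, at every finite stage, of points at which all steps expand. Then λ at x is nondecreasing. If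
it is unbounded, convergence is immediate. Otherwise the expansion per step tends to 1; since each
factor has only finitely many points with `lam` equal to 1, the orbit of x eventually consists of
such points (`eventually_lam_eq_one`). From then on the steps are translations, bounded away from
zero by finiteness and of constant sign because common expanding points accumulate at x. So |τ|
grows linearly.

An infinite word of the interval shift is cut into blocks from B; the inclusion W_b ⊂ V_b places
every point of its limit set in the situation above, and incomplete last blocks, of bounded length,
do not matter (`norm_mobius_sub_center_le`). Limit sets are therefore singletons, compatibility
makes them cover the closures of the W_v, and compactness gives continuity. The conditions on Q_n
reduce to the first one, with B the words of length n. -/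

lemma norm_mobius_le (g : discGroup) {z : ℂ} (hz : ‖z‖ ≤ 1) : ‖mobius g z‖ ≤ 1 := by
  rw [← coe_mem_unitDisc, ← smul_coe _ (denom_ne_zero g hz), smul_mem_unitDisc, coe_mem_unitDisc]
  exact hz

lemma mobius_mul (g h : discGroup) {z : ℂ} (hz : ‖z‖ ≤ 1) :
    mobius ((g * h : discGroup) : GL (Fin 2) ℂ) z = mobius g (mobius h z) := by
  have h1 := smul_coe _ (denom_ne_zero (g * h) hz)
  rw [Subgroup.coe_mul, mul_smul, smul_coe _ (denom_ne_zero h hz),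
    smul_coe _ (denom_ne_zero g (norm_mobius_le h hz)), OnePoint.coe_eq_coe] at h1
  rw [Subgroup.coe_mul, h1]

@[simp]
lemma mobius_one (z : ℂ) : mobius ((1 : discGroup) : GL (Fin 2) ℂ) z = z := by
  simp [mobius]

@[simp]
lemma coe_onCircle (g : discGroup) (z : Circle) : (onCircle g z : ℂ) = mobius g z := rfl

lemma onCircle_mul (g h : discGroup) (z : Circle) :
    onCircle (g * h) z = onCircle g (onCircle h z) :=
  Circle.ext (mobius_mul g h (Circle.norm_coe z).le)

@[simp]
lemma onCircle_one (z : Circle) : onCircle 1 z = z :=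
  Circle.ext (mobius_one _)

@[simp]
lemma onCircle_inv_onCircle (g : discGroup) (z : Circle) : onCircle g⁻¹ (onCircle g z) = z := by
  rw [← onCircle_mul, inv_mul_cancel, onCircle_one]

@[simp]
lemma onCircle_onCircle_inv (g : discGroup) (z : Circle) : onCircle g (onCircle g⁻¹ z) = z := by
  rw [← onCircle_mul, mul_inv_cancel, onCircle_one]

lemma mem_image_onCircle (g : discGroup) (U : Set Circle) (x : Circle) :
    x ∈ onCircle g '' U ↔ onCircle g⁻¹ x ∈ U := by
  constructor
  · rintro ⟨y, hy, rfl⟩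
    simpa using hy
  · exact fun h => ⟨_, h, by simp⟩

lemma continuousOn_mobius (g : discGroup) :
    ContinuousOn (mobius (g : GL (Fin 2) ℂ)) (Metric.closedBall 0 1) := by
  unfold mobius
  exact ContinuousOn.div (by fun_prop) (by fun_prop)
    fun z hz => denom_ne_zero g (by simpa using hz)

@[fun_prop]
lemma continuous_onCircle (g : discGroup) : Continuous (onCircle g) := by
  have h : Continuous fun z : Circle => mobius (g : GL (Fin 2) ℂ) z :=
    (continuousOn_mobius g).comp_continuous continuous_subtype_val (by simp [Circle.norm_coe])
  exact Continuous.subtype_mk h _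

/-- The image of the origin under a disc preserving transformation. -/
def center (g : discGroup) : ℂ := mobius g 0

lemma center_eq (g : discGroup) :
    center g = (g : GL (Fin 2) ℂ) 0 1 / (g : GL (Fin 2) ℂ) 1 1 := by
  simp [center, mobius]

@[simp]
lemma center_one : center 1 = 0 :=
  mobius_one 0

lemma center_mul (g h : discGroup) : center (g * h) = mobius g (center h) :=
  mobius_mul g h (by simp)

lemma det_ne_zero (g : GL (Fin 2) ℂ) : g 0 0 * g 1 1 - g 0 1 * g 1 0 ≠ 0 := by
  rw [← Matrix.det_fin_two]
  exact g.det_ne_zero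

/-- Otherwise the pole -d/c would lie in the closed disc, or the denominator would vanish
identically. -/
lemma norm_entry_lt (g : discGroup) :
    ‖(g : GL (Fin 2) ℂ) 1 0‖ < ‖(g : GL (Fin 2) ℂ) 1 1‖ := by
  by_contra! h
  set c := (g : GL (Fin 2) ℂ) 1 0
  set d := (g : GL (Fin 2) ℂ) 1 1
  have hc : c ≠ 0 := by
    intro hc
    have hd : d = 0 := by simpa [hc] using h
    exact denom_ne_zero g (z := 0) (by simp) (by simp [c, d] at hc hd; simp [hc, hd])
  refine denom_ne_zero g (z := -d / c) ?_ ?_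
  · rw [norm_div, norm_neg]
    exact div_le_one_of_le₀ h (norm_nonneg _)
  · change c * (-d / c) + d = 0
    field_simp
    ring

lemma norm_num_eq_norm_denom (g : discGroup) {z : ℂ} (hz : ‖z‖ = 1) :
    ‖(g : GL (Fin 2) ℂ) 0 0 * z + (g : GL (Fin 2) ℂ) 0 1‖ =
      ‖(g : GL (Fin 2) ℂ) 1 0 * z + (g : GL (Fin 2) ℂ) 1 1‖ := by
  have h := norm_mobius g ⟨z, mem_sphere_zero_iff_norm.2 hz⟩
  rw [mobius, norm_div] at h
  exact (div_eq_one_iff_eq (norm_ne_zero_iff.2 (denom_ne_zero g hz.le))).1 h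

/-- Equality of |az + b| and |cz + d| at ±1 and ±i gives |a|² + |b|² = |c|² + |d|² and a b̄ = c d̄.
So the pairs |a|², |b|² and |c|², |d|² have the same sum and product; the matching |a| = |c| would
make the determinant vanish. -/
lemma normSq_entries (g : discGroup) :
    Complex.normSq ((g : GL (Fin 2) ℂ) 0 0) = Complex.normSq ((g : GL (Fin 2) ℂ) 1 1) ∧
    Complex.normSq ((g : GL (Fin 2) ℂ) 0 1) = Complex.normSq ((g : GL (Fin 2) ℂ) 1 0) ∧
    Complex.normSq ((g : GL (Fin 2) ℂ) 0 0 * (g : GL (Fin 2) ℂ) 1 1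
        - (g : GL (Fin 2) ℂ) 0 1 * (g : GL (Fin 2) ℂ) 1 0) =
      (Complex.normSq ((g : GL (Fin 2) ℂ) 1 1) - Complex.normSq ((g : GL (Fin 2) ℂ) 0 1)) ^ 2 := by
  have key : ∀ z : ℂ, ‖z‖ = 1 →
      Complex.normSq ((g : GL (Fin 2) ℂ) 0 0 * z + (g : GL (Fin 2) ℂ) 0 1) =
      Complex.normSq ((g : GL (Fin 2) ℂ) 1 0 * z + (g : GL (Fin 2) ℂ) 1 1) := fun z hz => by
    rw [Complex.normSq_eq_norm_sq, Complex.normSq_eq_norm_sq, norm_num_eq_norm_denom g hz]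
  have h1 := key 1 (by simp)
  have h2 := key (-1) (by simp)
  have h3 := key Complex.I (by simp)
  have h4 := key (-Complex.I) (by simp)
  have hdet : Complex.normSq _ ≠ 0 := fun h => det_ne_zero (g : GL (Fin 2) ℂ)
    (Complex.normSq_eq_zero.1 h)
  generalize (g : GL (Fin 2) ℂ) 0 0 = a at *
  generalize (g : GL (Fin 2) ℂ) 0 1 = b at *
  generalize (g : GL (Fin 2) ℂ) 1 0 = c at *
  generalize (g : GL (Fin 2) ℂ) 1 1 = d at *
  obtain ⟨a1, a2⟩ := a
  obtain ⟨b1, b2⟩ := b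
  obtain ⟨c1, c2⟩ := c
  obtain ⟨d1, d2⟩ := d
  simp [Complex.normSq_apply] at h1 h2 h3 h4 hdet ⊢
  have s : a1*a1+a2*a2+(b1*b1+b2*b2) = c1*c1+c2*c2+(d1*d1+d2*d2) := by linarith
  have re : a1*b1+a2*b2 = c1*d1+c2*d2 := by linarith
  have im : a2*b1-a1*b2 = c2*d1-c1*d2 := by linarith
  have pr : (a1*a1+a2*a2)*(b1*b1+b2*b2) = (c1*c1+c2*c2)*(d1*d1+d2*d2) := by
    linear_combination (a1*b1+a2*b2 + c1*d1+c2*d2) * re + (a2*b1-a1*b2+(c2*d1-c1*d2)) * im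
  have hd : (a1*d1-a2*d2-(b1*c1-b2*c2))*(a1*d1-a2*d2-(b1*c1-b2*c2)) +
      (a1*d2+a2*d1-(b1*c2+b2*c1))*(a1*d2+a2*d1-(b1*c2+b2*c1)) =
      (a1*a1+a2*a2)*(d1*d1+d2*d2) + (b1*b1+b2*b2)*(c1*c1+c2*c2)
        - 2*((c1*c1+c2*c2)*(d1*d1+d2*d2)) := by
    linear_combination (-2) * (c1*d1+c2*d2) * re + (-2)*(c2*d1-c1*d2) * im
  rw [hd] at hdet ⊢
  have hf : (a1*a1+a2*a2 - (c1*c1+c2*c2)) * (a1*a1+a2*a2 - (d1*d1+d2*d2)) = 0 := by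
    linear_combination (-1) * pr + (a1*a1+a2*a2) * s
  rcases mul_eq_zero.1 hf with h | h
  · exfalso
    apply hdet
    linear_combination ((d1*d1+d2*d2) - (c1*c1+c2*c2)) * h + (c1*c1+c2*c2) * s
  · have h' : b1*b1+b2*b2 = c1*c1+c2*c2 := by linarith
    refine ⟨by linarith, h', ?_⟩
    rw [h']
    linear_combination (d1*d1+d2*d2) * h

lemma norm_center_lt (g : discGroup) : ‖center g‖ < 1 := by
  have h := (normSq_entries g).2.1
  rw [Complex.normSq_eq_norm_sq, Complex.normSq_eq_norm_sq,
    sq_eq_sq₀ (norm_nonneg _) (norm_nonneg _)] at h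
  rw [center_eq, norm_div, h]
  exact (div_lt_one ((norm_nonneg _).trans_lt (norm_entry_lt g))).2 (norm_entry_lt g)

/-- Makes a factor from a finite set harmless on the right of g once `center g` is near the circle.
The difference is Dz / (d(cz + d)) with D the determinant, |D| = |d|² - |b|² and |cz + d| ≥ |d|(1 -
|z|). -/
lemma norm_mobius_sub_center_le (g : discGroup) {z : ℂ} (hz : ‖z‖ < 1) :
    ‖mobius g z - center g‖ ≤ (1 - ‖center g‖ ^ 2) * (‖z‖ / (1 - ‖z‖)) := by
  have h1 := normSq_entries g
  have h2 := norm_entry_lt g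
  have h3 := denom_ne_zero g hz.le
  rw [center_eq, mobius]
  generalize (g : GL (Fin 2) ℂ) 0 0 = a at *
  generalize (g : GL (Fin 2) ℂ) 0 1 = b at *
  generalize (g : GL (Fin 2) ℂ) 1 0 = c at *
  generalize (g : GL (Fin 2) ℂ) 1 1 = d at *
  obtain ⟨-, hb, hdet⟩ := h1
  simp only [Complex.normSq_eq_norm_sq] at hb hdet
  rw [sq_eq_sq₀ (norm_nonneg _) (norm_nonneg _)] at hb
  have hd0 : 0 < ‖d‖ := (norm_nonneg _).trans_lt h2
  have hd : d ≠ 0 := norm_pos_iff.1 hd0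
  rw [sq_eq_sq₀ (norm_nonneg _) (by nlinarith [norm_nonneg b])] at hdet
  have e : (a * z + b) / (c * z + d) - b / d = (a * d - b * c) * z / (d * (c * z + d)) := by
    rw [div_sub_div _ _ h3 hd, mul_comm d]
    congr 1
    ring
  have hz1 : 0 < 1 - ‖z‖ := by linarith
  have hden : ‖d‖ * (1 - ‖z‖) ≤ ‖c * z + d‖ := by
    have h := norm_sub_le (c * z + d) (c * z)
    rw [add_sub_cancel_left, norm_mul] at h
    nlinarith [norm_nonneg z]
  rw [e, norm_div, norm_mul, norm_mul, hdet, norm_div]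
  have hnn : 0 ≤ (‖d‖ ^ 2 - ‖b‖ ^ 2) * ‖z‖ :=
    mul_nonneg (by nlinarith [norm_nonneg b]) (norm_nonneg _)
  calc (‖d‖ ^ 2 - ‖b‖ ^ 2) * ‖z‖ / (‖d‖ * ‖c * z + d‖)
      ≤ (‖d‖ ^ 2 - ‖b‖ ^ 2) * ‖z‖ / (‖d‖ * (‖d‖ * (1 - ‖z‖))) := by gcongr
    _ = _ := by field_simp

lemma isRotation_of_center_eq_zero (g : discGroup) (h : center g = 0) : IsRotation g := by
  have h1 := normSq_entries g
  have h2 := norm_entry_lt g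
  have hd0 := (norm_nonneg _).trans_lt h2
  have hd := norm_pos_iff.1 hd0
  rw [center_eq, div_eq_zero_iff, or_iff_left hd] at h
  have hc : (g : GL (Fin 2) ℂ) 1 0 = 0 := by
    simpa [h] using h1.2.1.symm
  have ha := h1.1
  rw [Complex.normSq_eq_norm_sq, Complex.normSq_eq_norm_sq,
    sq_eq_sq₀ (norm_nonneg _) (norm_nonneg _)] at ha
  have hn : ‖(g : GL (Fin 2) ℂ) 0 0 / (g : GL (Fin 2) ℂ) 1 1‖ = 1 := by
    rw [norm_div, ha, div_self hd0.ne']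
  obtain ⟨θ, hθ⟩ := (Complex.norm_eq_one_iff _).1 hn
  refine ⟨θ, fun z => ?_⟩
  rw [smul_coe _ (by rwa [hc, zero_mul, zero_add]), mobius, hθ, h, hc]
  congr 1
  rw [zero_mul, zero_add, add_zero, div_mul_eq_mul_div]

/-! ### Derivatives -/

lemma hasDerivAt_mobius (g : discGroup) {z : ℂ} (hz : ‖z‖ ≤ 1) :
    HasDerivAt (mobius (g : GL (Fin 2) ℂ))
      (((g : GL (Fin 2) ℂ) 0 0 * (g : GL (Fin 2) ℂ) 1 1
        - (g : GL (Fin 2) ℂ) 0 1 * (g : GL (Fin 2) ℂ) 1 0) /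
        ((g : GL (Fin 2) ℂ) 1 0 * z + (g : GL (Fin 2) ℂ) 1 1) ^ 2) z := by
  have h1 : HasDerivAt (fun z => (g : GL (Fin 2) ℂ) 0 0 * z + (g : GL (Fin 2) ℂ) 0 1)
      ((g : GL (Fin 2) ℂ) 0 0 * 1) z := ((hasDerivAt_id z).const_mul _).add_const _
  have h2 : HasDerivAt (fun z => (g : GL (Fin 2) ℂ) 1 0 * z + (g : GL (Fin 2) ℂ) 1 1)
      ((g : GL (Fin 2) ℂ) 1 0 * 1) z := ((hasDerivAt_id z).const_mul _).add_const _
  refine (h1.div h2 (denom_ne_zero g hz)).congr_deriv ?_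
  congr 1
  ring

lemma derivModulus_eq (g : discGroup) (x : Circle) :
    derivModulus g x = ‖(g : GL (Fin 2) ℂ) 0 0 * (g : GL (Fin 2) ℂ) 1 1
        - (g : GL (Fin 2) ℂ) 0 1 * (g : GL (Fin 2) ℂ) 1 0‖ /
        ‖(g : GL (Fin 2) ℂ) 1 0 * x + (g : GL (Fin 2) ℂ) 1 1‖ ^ 2 := by
  rw [derivModulus, (hasDerivAt_mobius g (Circle.norm_coe x).le).deriv, norm_div, norm_pow]

lemma derivModulus_pos (g : discGroup) (x : Circle) : 0 < derivModulus g x := by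
  rw [derivModulus_eq]
  have h1 := norm_pos_iff.2 (det_ne_zero (g : GL (Fin 2) ℂ))
  have h2 := norm_pos_iff.2 (denom_ne_zero g (Circle.norm_coe x).le)
  positivity

lemma continuous_derivModulus (g : discGroup) : Continuous (derivModulus g) := by
  simp_rw [funext (derivModulus_eq g)]
  exact Continuous.div (by fun_prop) (by fun_prop) fun x =>
    pow_ne_zero _ (norm_ne_zero_iff.2 (denom_ne_zero g (Circle.norm_coe x).le))

lemma mobius_sub_mobius (g : discGroup) {x y : ℂ} (hx : ‖x‖ ≤ 1) (hy : ‖y‖ ≤ 1) :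
    mobius g x - mobius g y = ((g : GL (Fin 2) ℂ) 0 0 * (g : GL (Fin 2) ℂ) 1 1
        - (g : GL (Fin 2) ℂ) 0 1 * (g : GL (Fin 2) ℂ) 1 0) * (x - y) /
        (((g : GL (Fin 2) ℂ) 1 0 * x + (g : GL (Fin 2) ℂ) 1 1) *
          ((g : GL (Fin 2) ℂ) 1 0 * y + (g : GL (Fin 2) ℂ) 1 1)) := by
  rw [mobius, mobius, div_sub_div _ _ (denom_ne_zero g hx) (denom_ne_zero g hy)]
  congr 1
  ring

lemma circle_dist_eq (x y : Circle) : dist x y = ‖(x : ℂ) - y‖ := by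
  rw [← dist_eq_norm]
  rfl

lemma dist_onCircle_sq (g : discGroup) (x y : Circle) :
    dist (onCircle g x) (onCircle g y) ^ 2 =
      derivModulus g x * derivModulus g y * dist x y ^ 2 := by
  rw [circle_dist_eq, circle_dist_eq, coe_onCircle, coe_onCircle,
    mobius_sub_mobius g (Circle.norm_coe x).le (Circle.norm_coe y).le, derivModulus_eq,
    derivModulus_eq, norm_div, norm_mul, norm_mul]
  have h1 := norm_ne_zero_iff.2 (denom_ne_zero g (Circle.norm_coe x).le)
  have h2 := norm_ne_zero_iff.2 (denom_ne_zero g (Circle.norm_coe y).le)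
  field_simp

/-! ### Half-plane coordinates -/

/-- The Cayley coordinate which sends the unit disc to the right half-plane and `x` to infinity. -/
def cay (x z : ℂ) : ℂ := (x + z) / (x - z)

lemma re_cay (x z : ℂ) : (cay x z).re = (‖x‖ ^ 2 - ‖z‖ ^ 2) / ‖x - z‖ ^ 2 := by
  rw [cay, Complex.div_re, ← add_div, ← Complex.normSq_eq_norm_sq, ← Complex.normSq_eq_norm_sq,
    ← Complex.normSq_eq_norm_sq]
  congr 1
  simp only [Complex.normSq_apply, Complex.add_re, Complex.add_im, Complex.sub_re, Complex.sub_im]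
  ring

lemma cay_eq_of_circle (x z : Circle) : cay x z = (cay x z).im * Complex.I := by
  apply Complex.ext
  · rw [re_cay]
    simp [Circle.norm_coe]
  · simp

/-- Follows from 1 + `cay x z` = 2x / (x - z). It turns closeness to x into a large imaginary
coordinate. -/
lemma dist_sq_mul_one_add_im_cay_sq {x z : Circle} (h : z ≠ x) :
    dist x z ^ 2 * (1 + (cay x z).im ^ 2) = 4 := by
  have h0 : (x : ℂ) - z ≠ 0 := sub_ne_zero.2 fun e => h (Circle.ext e.symm)
  have h1 : 1 + cay x z = 2 * x / (x - z) := by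
    rw [cay]
    field_simp
    ring
  have h2 : Complex.normSq (1 + cay x z) = 1 + (cay x z).im ^ 2 := by
    rw [cay_eq_of_circle x z]
    simp [Complex.normSq_apply]
    ring
  rw [← h2, h1, Complex.normSq_eq_norm_sq, norm_div, norm_mul, Circle.norm_coe, circle_dist_eq]
  have := norm_ne_zero_iff.2 h0
  field_simp
  norm_num

/-- The modulus of the derivative of `g⁻¹` at a point `y` of the circle, which is the Poisson kernel
of the point `center g`. -/
def lam (g : discGroup) (y : Circle) : ℝ := (cay y (center g)).re

/-- The translation part of `g` in the coordinate `cay`. -/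
def tau (g : discGroup) (y : Circle) : ℝ := (cay y (center g)).im

lemma cay_center (g : discGroup) (y : Circle) :
    cay y (center g) = lam g y + tau g y * Complex.I :=
  (Complex.re_add_im _).symm

@[simp]
lemma cay_zero (y : Circle) : cay y 0 = 1 := by
  simp [cay]

lemma lam_eq (g : discGroup) (y : Circle) :
    lam g y = (1 - ‖center g‖ ^ 2) / ‖(y : ℂ) - center g‖ ^ 2 := by
  rw [lam, re_cay, Circle.norm_coe, one_pow]

lemma circle_sub_ne_zero (y : Circle) {z : ℂ} (hz : ‖z‖ < 1) : (y : ℂ) - z ≠ 0 := by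
  intro h
  rw [sub_eq_zero] at h
  rw [← h, Circle.norm_coe] at hz
  exact lt_irrefl _ hz

/-- In these coordinates g is a Möbius map fixing infinity, hence affine. -/
lemma exists_cay_mobius_affine (g : discGroup) (x : Circle) :
    ∃ p q : ℂ, ∀ z : ℂ, ‖z‖ ≤ 1 → z ≠ x →
      cay (mobius g x) (mobius g z) = p * cay x z + q := by
  have hx := denom_ne_zero g (Circle.norm_coe x).le
  have hD := det_ne_zero (g : GL (Fin 2) ℂ)
  have hx0 := x.coe_ne_zero
  have hsub := fun z hz => mobius_sub_mobius g (x := x) (y := z) (Circle.norm_coe x).le hz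
  have hden := fun z hz => denom_ne_zero g (z := z) hz
  simp only [cay]
  generalize hx' : (x : ℂ) = x' at *
  generalize hD' : (g : GL (Fin 2) ℂ) 0 0 * (g : GL (Fin 2) ℂ) 1 1
        - (g : GL (Fin 2) ℂ) 0 1 * (g : GL (Fin 2) ℂ) 1 0 = D at *
  simp only [mobius] at *
  generalize (g : GL (Fin 2) ℂ) 0 0 = a at *
  generalize (g : GL (Fin 2) ℂ) 0 1 = b at *
  generalize (g : GL (Fin 2) ℂ) 1 0 = c at *
  generalize (g : GL (Fin 2) ℂ) 1 1 = d at *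
  set A := (a * x' + b) * c + a * (c * x' + d)
  set B := (a * x' + b) * d + b * (c * x' + d)
  -- The value is (Az + B) / (D(x' - z)). With w = `cay x' z` one has z / (x' - z) = (w - 1)/2 and 1
  -- / (x' - z) = (w + 1)/(2x').
  refine ⟨(B / x' + A) / 2 / D, (B / x' - A) / 2 / D, fun z hz hzx => ?_⟩
  have hzx' : x' - z ≠ 0 := sub_ne_zero.2 hzx.symm
  have hz' := hden z hz
  rw [hsub z hz, div_add_div _ _ hx hz', div_div_div_cancel_right₀ (mul_ne_zero hx hz')]
  simp only [A, B]
  field_simp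
  ring

/-- The affine map preserves the imaginary axis, the image of the circle, so p is real and q
imaginary: test it at -x and ix, whose coordinates are 0 and i. The origin has coordinate 1, so p +
q is the coordinate of `center g`. -/
lemma cay_mobius (g : discGroup) (x : Circle) {z : ℂ} (hz : ‖z‖ ≤ 1) (hzx : z ≠ x) :
    cay (mobius g x) (mobius g z) =
      lam g (onCircle g x) * cay x z + tau g (onCircle g x) * Complex.I := by
  obtain ⟨p, q, h⟩ := exists_cay_mobius_affine g x
  have hcirc : ∀ z : Circle, (p * cay x z + q).re = 0 ∨ z = x := fun z => by
    by_cases hzx : z = x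
    · exact Or.inr hzx
    · left
      rw [← h z (Circle.norm_coe z).le fun e => hzx (Circle.ext e), re_cay, norm_mobius,
        norm_mobius]
      simp
  have hx0 := x.coe_ne_zero
  have h1 : q.re = 0 := by
    rcases hcirc (-x) with h1 | h1
    · simpa [cay] using h1
    · exact absurd h1 (Circle.neg_ne_self x)
  have h2 : p.im = 0 := by
    have hI : (1 : ℂ) - Complex.I ≠ 0 := fun e => by simpa using congrArg Complex.re e
    rcases hcirc (x * Circle.exp (Real.pi / 2)) with h2 | h2
    · have e : cay x (x * Circle.exp (Real.pi / 2) : Circle) = Complex.I := by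
        rw [cay, Circle.coe_mul, Circle.coe_exp]
        push_cast
        rw [Complex.exp_pi_div_two_mul_I]
        rw [div_eq_iff (by rw [← mul_one_sub]; exact mul_ne_zero hx0 hI)]
        linear_combination (x : ℂ) * Complex.I_sq
      rw [e] at h2
      simpa [h1] using h2
    · exfalso
      have h3 : (Circle.exp (Real.pi / 2) : ℂ) = 1 := by
        rw [mul_eq_left] at h2
        rw [h2, Circle.coe_one]
      rw [Circle.coe_exp] at h3
      push_cast at h3
      rw [Complex.exp_pi_div_two_mul_I] at h3
      exact hI (by rw [h3, sub_self])
  have h0 := h 0 (by simp) hx0.symm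
  rw [cay_zero, mul_one] at h0
  have hp : p = lam g (onCircle g x) := by
    apply Complex.ext
    · simp [lam, center, h0, h1]
    · simp [h2]
  have hq : q = tau g (onCircle g x) * Complex.I := by
    apply Complex.ext
    · simp [h1]
    · simp [tau, center, h0, h2]
  rw [h z hz hzx, ← hp, ← hq]

/-- The distance formula for g followed by its inverse gives r x * r y = 1 for distinct x and y;
three distinct points force r = 1. -/
lemma derivModulus_inv_mul (g : discGroup) (x : Circle) :
    derivModulus g⁻¹ (onCircle g x) * derivModulus g x = 1 := by
  set r : Circle → ℝ := fun x => derivModulus g⁻¹ (onCircle g x) * derivModulus g x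
  have hr : ∀ x, 0 < r x := fun x => mul_pos (derivModulus_pos _ _) (derivModulus_pos _ _)
  have h : ∀ x y, x ≠ y → r x * r y = 1 := fun x y hxy => by
    have h1 := dist_onCircle_sq g⁻¹ (onCircle g x) (onCircle g y)
    rw [onCircle_inv_onCircle, onCircle_inv_onCircle, dist_onCircle_sq] at h1
    have h2 : dist x y ^ 2 ≠ 0 := pow_ne_zero _ (dist_ne_zero.2 hxy)
    have h3 : (r x * r y) * dist x y ^ 2 = 1 * dist x y ^ 2 := by
      rw [one_mul]
      exact Eq.trans (by simp only [r]; ring) h1.symm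
    exact mul_right_cancel₀ h2 h3
  have hne : ∀ s t : ℝ, 0 ≤ s → s < t → t < 2 * Real.pi →
      x * Circle.exp s ≠ x * Circle.exp t := fun s t h0 hst ht e => by
    have := Circle.exp_injOn_Ico (a := 0) (sub_zero _).le ⟨h0, hst.trans ht⟩
      ⟨h0.trans hst.le, ht⟩
      (mul_left_cancel e)
    exact hst.ne this
  have hpi := Real.pi_gt_three
  have h1 := h _ _ (hne 0 1 le_rfl one_pos (by linarith))
  have h2 := h _ _ (hne 0 2 le_rfl two_pos (by linarith))
  have h3 := h _ _ (hne 1 2 one_pos.le one_lt_two (by linarith))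
  rw [Circle.exp_zero, mul_one] at h1 h2
  have p1 := hr x
  have p2 := hr (x * Circle.exp 1)
  have p3 := hr (x * Circle.exp 2)
  have e1 : r (x * Circle.exp 1) = r (x * Circle.exp 2) :=
    mul_left_cancel₀ p1.ne' (h1.trans h2.symm)
  rw [← e1] at h3
  have e2 : r (x * Circle.exp 1) = 1 := by nlinarith
  rwa [e2, mul_one] at h1

lemma derivModulus_inv (g : discGroup) (y : Circle) : derivModulus g⁻¹ y = lam g y := by
  obtain ⟨x, rfl⟩ : ∃ x, onCircle g x = y := ⟨onCircle g⁻¹ y, by simp⟩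
  have h := derivModulus_inv_mul g x
  rw [← eq_div_iff (derivModulus_pos g x).ne'] at h
  rw [h, lam_eq, derivModulus_eq, coe_onCircle, center,
    mobius_sub_mobius g (Circle.norm_coe x).le (by simp), ← center, center_eq]
  have h1 := normSq_entries g
  have h2 := norm_entry_lt g
  have h3 := norm_ne_zero_iff.2 (denom_ne_zero g (Circle.norm_coe x).le)
  have h4 := norm_ne_zero_iff.2 (det_ne_zero (g : GL (Fin 2) ℂ))
  have h5 := ((norm_nonneg _).trans_lt h2).ne'
  obtain ⟨-, hb, hdet⟩ := h1
  simp only [Complex.normSq_eq_norm_sq] at hb hdet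
  rw [sq_eq_sq₀ (norm_nonneg _) (norm_nonneg _)] at hb
  rw [sq_eq_sq₀ (norm_nonneg _) (by rw [hb]; nlinarith [norm_nonneg ((g : GL (Fin 2) ℂ) 1 0)])]
    at hdet
  simp only [norm_div, norm_mul, mul_zero, zero_add, sub_zero, Circle.norm_coe, mul_one]
  generalize ‖(g : GL (Fin 2) ℂ) 0 0 * (g : GL (Fin 2) ℂ) 1 1
        - (g : GL (Fin 2) ℂ) 0 1 * (g : GL (Fin 2) ℂ) 1 0‖ = D at *
  field_simp
  rw [hdet]

lemma lam_pos (g : discGroup) (y : Circle) : 0 < lam g y := by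
  rw [← derivModulus_inv]
  exact derivModulus_pos _ _

lemma continuous_lam (g : discGroup) : Continuous (lam g) := by
  simp_rw [← funext (derivModulus_inv g)]
  exact continuous_derivModulus _

lemma mem_expansionInterval (g : discGroup) (x : Circle) :
    x ∈ expansionInterval g ↔ 1 < lam g x := by
  rw [expansionInterval, mem_ofPred_eq, derivModulus_inv]

lemma dist_onCircle_inv_sq (g : discGroup) (x y : Circle) :
    dist (onCircle g⁻¹ x) (onCircle g⁻¹ y) ^ 2 = lam g x * lam g y * dist x y ^ 2 := by
  rw [dist_onCircle_sq, derivModulus_inv, derivModulus_inv]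

lemma norm_cay_mul_le (y : Circle) {z : ℂ} (hz : ‖z‖ < 1) : ‖cay y z‖ * ‖(y : ℂ) - z‖ ≤ 2 := by
  have h := norm_ne_zero_iff.2 (circle_sub_ne_zero y hz)
  rw [cay, norm_div, div_mul_cancel₀ _ h]
  exact (norm_add_le _ _).trans (by rw [Circle.norm_coe]; linarith)

lemma tendsto_center_of_tendsto_cay {G : ℕ → discGroup} {x : Circle}
    (h : Tendsto (fun k => ‖cay x (center (G k))‖) atTop atTop) :
    Tendsto (fun k => center (G k)) atTop (𝓝 (x : ℂ)) := by
  rw [tendsto_iff_norm_sub_tendsto_zero]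
  refine squeeze_zero' (.of_forall fun _ => norm_nonneg _) ?_
    (tendsto_const_nhds.div_atTop h : Tendsto (fun k => (2 : ℝ) / _) atTop (𝓝 0))
  filter_upwards [h.eventually_gt_atTop 0] with k hk
  rw [le_div_iff₀ hk, mul_comm, norm_sub_rev]
  exact norm_cay_mul_le x (norm_center_lt _)

/-- When `lam g y` is 1, iτ equals `cay y (center g)` - 1 = 2c / (y - c) with c = `center g`, and |y
- c| ≤ 2. -/
lemma norm_center_le_abs_tau {g : discGroup} {y : Circle} (h : lam g y = 1) :
    ‖center g‖ ≤ |tau g y| := by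
  have h0 := circle_sub_ne_zero y (norm_center_lt g)
  have h1 : cay y (center g) - 1 = tau g y * Complex.I := by
    rw [cay_center, h, Complex.ofReal_one, add_sub_cancel_left]
  have h2 : cay y (center g) - 1 = 2 * center g / (y - center g) := by
    rw [cay]
    field_simp
    ring
  have h3 : ‖(y : ℂ) - center g‖ ≤ 2 :=
    (norm_sub_le _ _).trans (by rw [Circle.norm_coe]; linarith [norm_center_lt g])
  have h4 : |tau g y| = 2 * ‖center g‖ / ‖(y : ℂ) - center g‖ := by
    have h5 := congrArg norm (h1.symm.trans h2)
    simpa using h5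
  rw [h4, le_div_iff₀ (norm_pos_iff.2 h0)]
  nlinarith [norm_nonneg (center g)]

/-! ### Points where the derivative has modulus one -/

lemma norm_circle_sub_sq (y : Circle) (c : ℂ) :
    ‖(y : ℂ) - c‖ ^ 2 = 1 + ‖c‖ ^ 2 - 2 * (y * (starRingEnd ℂ) c).re := by
  rw [← Complex.normSq_eq_norm_sq, Complex.normSq_sub, Circle.normSq_coe,
    Complex.normSq_eq_norm_sq]

lemma one_le_lam_iff (g : discGroup) (y : Circle) :
    1 ≤ lam g y ↔ ‖center g‖ ^ 2 ≤ (y * (starRingEnd ℂ) (center g)).re := by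
  have h := norm_pos_iff.2 (circle_sub_ne_zero y (norm_center_lt g))
  rw [lam_eq, one_le_div (by positivity), norm_circle_sub_sq]
  constructor <;> intro h <;> linarith

lemma lam_eq_one_iff (g : discGroup) (y : Circle) :
    lam g y = 1 ↔ (y * (starRingEnd ℂ) (center g)).re = ‖center g‖ ^ 2 := by
  have h := norm_pos_iff.2 (circle_sub_ne_zero y (norm_center_lt g))
  rw [lam_eq, div_eq_one_iff_eq (by positivity), norm_circle_sub_sq]
  constructor <;> intro h <;> linarith

/-- Multiplying the equation for `lam g y = 1` by 2y and using ȳ = 1/y makes y a root of the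
quadratic c̄y² - 2|c|²y + c. -/
lemma finite_setOf_lam_eq_one {g : discGroup} (hg : center g ≠ 0) :
    {y : Circle | lam g y = 1}.Finite := by
  set c := center g
  let P : Polynomial ℂ := .C ((starRingEnd ℂ) c) * .X ^ 2 + .C (-2 * (‖c‖ ^ 2 : ℝ)) * .X + .C c
  have hP : P ≠ 0 := by
    intro h
    have := congrArg (Polynomial.eval 0) h
    simp [P] at this
    exact hg this
  refine Set.Finite.of_finite_image ((Polynomial.finite_setOfPred_isRoot hP).subset ?_)
    Circle.coe_injective.injOn
  rintro _ ⟨y, hy, rfl⟩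
  have h1 := (lam_eq_one_iff g y).1 hy
  have h2 : (y : ℂ) * (starRingEnd ℂ) c + (starRingEnd ℂ) (y * (starRingEnd ℂ) c) =
      2 * (‖c‖ ^ 2 : ℝ) := by
    rw [Complex.add_conj, h1]
    push_cast
    rfl
  rw [map_mul, Complex.conj_conj] at h2
  have h3 : (y : ℂ) * (starRingEnd ℂ) (y : ℂ) = 1 := by
    rw [Complex.mul_conj, Circle.normSq_coe, Complex.ofReal_one]
  simp only [P, mem_ofPred_eq, Polynomial.IsRoot, Polynomial.eval_add, Polynomial.eval_mul,
    Polynomial.eval_C, Polynomial.eval_pow, Polynomial.eval_X]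
  linear_combination (y : ℂ) * h2 - c * h3

/-- An open set on which `F⁻¹` is nowhere contracting lies in the expansion interval, if `F` is
not a rotation. -/
lemma subset_expansionInterval_of_one_le {g : discGroup} (hg : center g ≠ 0) {U : Set Circle}
    (hU : IsOpen U) (h : ∀ x ∈ U, 1 ≤ lam g x) : U ⊆ expansionInterval g := by
  intro x hx
  rw [mem_expansionInterval]
  refine lt_of_le_of_ne (h x hx) fun he => ?_
  have h1 := (lam_eq_one_iff g x).1 he.symm
  have hcont : Continuous fun θ : ℝ => x * Circle.exp θ := by fun_prop
  have hev : ∀ᶠ θ in 𝓝 (0 : ℝ), x * Circle.exp θ ∈ U :=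
    hcont.continuousAt.eventually_mem (hU.mem_nhds (by simpa using hx))
  obtain ⟨δ, hδ, hball⟩ := Metric.eventually_nhds_iff.1 hev
  have key : ∀ θ, |θ| < δ → ‖center g‖ ^ 2 ≤ ‖center g‖ ^ 2 * Real.cos θ -
      (x * (starRingEnd ℂ) (center g)).im * Real.sin θ := fun θ hθ => by
    have h2 := (one_le_lam_iff g _).1 (h _ (hball (by simpa using hθ)))
    rw [Circle.coe_mul, mul_right_comm, Complex.mul_re, h1, Circle.coe_exp,
      Complex.exp_ofReal_mul_I_re, Complex.exp_ofReal_mul_I_im] at h2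
    exact h2
  set θ := min (δ / 2) 1
  have hθ0 : 0 < θ := lt_min (by linarith) one_pos
  have hθδ : |θ| < δ := by
    rw [abs_of_pos hθ0]
    exact (min_le_left _ _).trans_lt (by linarith)
  have hs : 0 < Real.sin θ :=
    Real.sin_pos_of_pos_of_le_one hθ0 (min_le_right _ _)
  have hc : Real.cos θ < 1 := by nlinarith [Real.sin_sq_add_cos_sq θ, Real.cos_le_one θ]
  have hc0 : 0 < ‖center g‖ ^ 2 := by
    have := norm_pos_iff.2 hg
    positivity
  -- Adding the inequalities at θ and -θ cancels the sine terms and leaves |c|² ≤ |c|² cos θ, which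
  -- is false.
  have k1 := key θ hθδ
  have k2 := key (-θ) (by rwa [abs_neg])
  rw [Real.cos_neg, Real.sin_neg] at k2
  nlinarith

/-! ### Representation of points -/

instance : IsProbabilityMeasure uniformMeasure := by
  constructor
  rw [uniformMeasure, Measure.map_apply (by fun_prop) MeasurableSet.univ]
  have h := Real.two_pi_pos
  simp only [preimage_univ, Measure.smul_apply, MeasurableSet.univ, Measure.restrict_apply,
    univ_inter, Real.volume_Ioc, sub_zero, smul_eq_mul]
  rw [← ENNReal.ofReal_mul (by positivity), inv_mul_cancel₀ h.ne', ENNReal.ofReal_one]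

lemma integral_uniformMeasure {f : Circle → ℂ} (hf : Continuous f) :
    ∫ z, f z ∂uniformMeasure = (2 * Real.pi)⁻¹ • ∫ θ in 0..2 * Real.pi, f (Circle.exp θ) := by
  have h := Real.two_pi_pos
  rw [uniformMeasure, integral_map (by fun_prop) hf.aestronglyMeasurable, integral_smul_measure,
    intervalIntegral.integral_of_le h.le, ENNReal.toReal_ofReal (by positivity)]

lemma integrable_uniformMeasure {E : Type*} [NormedAddCommGroup E] {f : Circle → E}
    (hf : Continuous f) : Integrable f uniformMeasure := by
  rw [← integrableOn_univ]
  exact hf.continuousOn.integrableOn_compact isCompact_univ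

/-- The mean value property: the barycentre of the image of the uniform measure. -/
lemma integral_mobius (g : discGroup) : ∫ z : Circle, mobius g z ∂uniformMeasure = center g := by
  have hc : Continuous fun z : Circle => mobius g z :=
    continuous_subtype_val.comp (continuous_onCircle g)
  have hd : DiffContOnCl ℂ (mobius (g : GL (Fin 2) ℂ)) (Metric.ball 0 |(1 : ℝ)|) := by
    rw [abs_one]
    refine ⟨fun z hz => ?_, ?_⟩
    · exact (hasDerivAt_mobius g (mem_ball_zero_iff.1 hz).le).differentiableAt.differentiableWithinAt
    · rw [closure_ball _ one_ne_zero]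
      exact continuousOn_mobius g
  rw [integral_uniformMeasure hc, center, ← hd.circleAverage, Real.circleAverage_def]
  simp [circleMap]

lemma integral_dist_sq (g : discGroup) (x : Circle) :
    ∫ z, dist (onCircle g z) x ^ 2 ∂uniformMeasure =
      2 - 2 * ((starRingEnd ℂ) (x : ℂ) * center g).re := by
  have hc : Continuous fun z : Circle => mobius g z :=
    continuous_subtype_val.comp (continuous_onCircle g)
  have h1 : ∀ z : Circle, dist (onCircle g z) x ^ 2 =
      2 - 2 * ((starRingEnd ℂ) (x : ℂ) * mobius g z).re := fun z => by
    rw [circle_dist_eq, ← Complex.normSq_eq_norm_sq, Complex.normSq_sub, Circle.normSq_coe,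
      Circle.normSq_coe, coe_onCircle, mul_comm (mobius _ _)]
    norm_num
  have h2 : Integrable (fun z : Circle => (starRingEnd ℂ) (x : ℂ) * mobius g z) uniformMeasure :=
    integrable_uniformMeasure (by fun_prop)
  have h3 : ∫ z : Circle, ((starRingEnd ℂ) (x : ℂ) * mobius g z).re ∂uniformMeasure =
      ((starRingEnd ℂ) (x : ℂ) * center g).re := by
    rw [← integral_mobius, ← integral_const_mul]
    exact integral_re h2
  simp_rw [h1]
  have h4 : Integrable (fun z : Circle => ((starRingEnd ℂ) (x : ℂ) * mobius g z).re)
    uniformMeasure := h2.re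
  rw [integral_sub (integrable_const _) (h4.const_mul 2), integral_const_mul, h3]
  simp

/-- A barycentre tending to a point x of the circle forces the mean squared distance to x to vanish.
A Chebyshev estimate then handles every continuous test function. -/
lemma represents_of_tendsto_center {g : ℕ → discGroup} {x : Circle}
    (h : Tendsto (fun n => center (g n)) atTop (𝓝 (x : ℂ))) : Represents g x := by
  intro f
  rw [integral_dirac]
  simp_rw [fun n => integral_map (μ := uniformMeasure)
    (continuous_onCircle (g n)).measurable.aemeasurable
    f.continuous.aestronglyMeasurable]
  have hlim : Tendsto (fun n => 2 - 2 * ((starRingEnd ℂ) (x : ℂ) * center (g n)).re) atTop (𝓝 0) := by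
    have h1 : ((starRingEnd ℂ) (x : ℂ) * x).re = 1 := by
      rw [mul_comm, Complex.mul_conj, Circle.normSq_coe]
      simp
    have h2 := (Complex.continuous_re.tendsto _).comp (h.const_mul ((starRingEnd ℂ) (x : ℂ)))
    rw [h1] at h2
    have h3 := (h2.const_mul 2).const_sub 2
    norm_num at h3
    simpa using h3
  rw [Metric.tendsto_atTop']
  intro ε hε
  obtain ⟨δ, hδ, hf⟩ := Metric.continuousAt_iff.1 (f.continuous.continuousAt (x := x)) (ε / 2)
    (half_pos hε)
  set C := 2 * ‖f‖ / δ ^ 2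
  have hbound : ∀ y, ‖f y - f x‖ ≤ ε / 2 + C * dist y x ^ 2 := fun y => by
    rcases lt_or_ge (dist y x) δ with hy | hy
    · have := (hf hy).le
      rw [dist_eq_norm] at this
      have : 0 ≤ C * dist y x ^ 2 := by positivity
      linarith
    · have h1 : ‖f y - f x‖ ≤ 2 * ‖f‖ := by
        rw [two_mul]
        exact (norm_sub_le _ _).trans (add_le_add (f.norm_coe_le_norm _) (f.norm_coe_le_norm _))
      have h2 : 2 * ‖f‖ ≤ C * dist y x ^ 2 := by
        rw [div_mul_eq_mul_div, le_div_iff₀ (by positivity)]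
        gcongr
      linarith
  have hev : ∀ᶠ n in atTop, C * (2 - 2 * ((starRingEnd ℂ) (x : ℂ) * center (g n)).re) < ε / 2 := by
    have := hlim.const_mul C
    rw [mul_zero] at this
    exact this.eventually_lt_const (half_pos hε)
  obtain ⟨N, hN⟩ := eventually_atTop.1 hev
  refine ⟨N, fun n hn => ?_⟩
  have hfi : Integrable (fun z => f (onCircle (g n) z)) uniformMeasure :=
    integrable_uniformMeasure (by fun_prop)
  have hdi : Integrable (fun z => dist (onCircle (g n) z) x ^ 2) uniformMeasure :=
    integrable_uniformMeasure (by fun_prop)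
  have e : ∫ z, f (onCircle (g n) z) ∂uniformMeasure - f x =
      ∫ z, (f (onCircle (g n) z) - f x) ∂uniformMeasure := by
    rw [integral_sub hfi (integrable_const _)]
    simp
  rw [dist_eq_norm, e]
  calc ‖∫ z, (f (onCircle (g n) z) - f x) ∂uniformMeasure‖
      ≤ ∫ z, ‖f (onCircle (g n) z) - f x‖ ∂uniformMeasure := norm_integral_le_integral_norm _
    _ ≤ ∫ z, (ε / 2 + C * dist (onCircle (g n) z) x ^ 2) ∂uniformMeasure :=
      integral_mono (hfi.sub (integrable_const _)).norm
        ((integrable_const _).add (hdi.const_mul C)) fun z => hbound _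
    _ = ε / 2 + C * (2 - 2 * ((starRingEnd ℂ) (x : ℂ) * center (g n)).re) := by
      rw [integral_add (integrable_const _) (hdi.const_mul C), integral_const_mul,
        integral_dist_sq]
      simp
    _ < ε := by linarith [hN n hn.le]

lemma Represents.unique {g : ℕ → discGroup} {x y : Circle} (hx : Represents g x)
    (hy : Represents g y) : x = y := by
  have h := tendsto_nhds_unique (hx ⟨fun z => dist z x, by fun_prop⟩)
    (hy ⟨fun z => dist z x, by fun_prop⟩)
  rw [integral_dirac, integral_dirac] at h
  simpa [eq_comm] using h

/-! ### Convergence of expanding products -/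

lemma circle_center_ne (g : discGroup) (x : Circle) : center g ≠ x := fun h => by
  have := norm_center_lt g
  rw [h, Circle.norm_coe] at this
  exact lt_irrefl _ this

lemma cay_mobius_inv (g : discGroup) (x : Circle) {z : ℂ} (hz : ‖z‖ ≤ 1)
    (hzx : z ≠ onCircle g⁻¹ x) :
    cay x (mobius g z) = lam g x * cay (onCircle g⁻¹ x) z + tau g x * Complex.I := by
  have h := cay_mobius g (onCircle g⁻¹ x) hz hzx
  rwa [← coe_onCircle g (onCircle g⁻¹ x), onCircle_onCircle_inv] at h

lemma cay_center_mul (g h : discGroup) (x : Circle) :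
    cay x (center (g * h)) =
      lam g x * cay (onCircle g⁻¹ x) (center h) + tau g x * Complex.I := by
  rw [center_mul, cay_mobius_inv g x (norm_center_lt h).le (circle_center_ne _ _)]

lemma lam_mul (g h : discGroup) (x : Circle) :
    lam (g * h) x = lam g x * lam h (onCircle g⁻¹ x) := by
  rw [lam, cay_center_mul]
  simp [lam]

lemma tau_mul (g h : discGroup) (x : Circle) :
    tau (g * h) x = lam g x * tau h (onCircle g⁻¹ x) + tau g x := by
  rw [tau, cay_center_mul]
  simp [tau]

@[simp]
lemma lam_one (x : Circle) : lam 1 x = 1 := by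
  simp [lam]

@[simp]
lemma tau_one (x : Circle) : tau 1 x = 0 := by
  simp [tau]

lemma onCircle_inv_injective (g : discGroup) : Function.Injective (onCircle g⁻¹) := fun x y h => by
  rw [← onCircle_onCircle_inv g x, h, onCircle_onCircle_inv]

lemma im_cay_eq {g : discGroup} {x z : Circle} (h : lam g x = 1) (hz : z ≠ x) :
    (cay x z).im = (cay (onCircle g⁻¹ x) (onCircle g⁻¹ z)).im + tau g x := by
  have h1 := cay_mobius_inv g x (Circle.norm_coe (onCircle g⁻¹ z)).le
    (fun e => hz (onCircle_inv_injective g (Circle.ext e)))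
  rw [← coe_onCircle g (onCircle g⁻¹ z), onCircle_onCircle_inv, h] at h1
  rw [h1]
  simp

/-- With `lam g x` equal to 1, the inverse of g acts on imaginary coordinates as ξ ↦ ξ - τ.
Expansion at z means moving away from x, that is |ξ - τ| < |ξ|, so τ has the sign of ξ. -/
lemma tau_mul_im_cay_pos {g : discGroup} {x z : Circle} (hx : lam g x = 1) (hz : 1 < lam g z) :
    0 < tau g x * (cay x z).im := by
  have hne : z ≠ x := fun e => by rw [e, hx] at hz; exact lt_irrefl _ hz
  have h1 := dist_sq_mul_one_add_im_cay_sq hne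
  have h2 := dist_sq_mul_one_add_im_cay_sq ((onCircle_inv_injective g).ne hne)
  rw [dist_onCircle_inv_sq, hx, one_mul] at h2
  have h3 := im_cay_eq hx hne
  have hd : 0 < dist x z ^ 2 := pow_pos (dist_pos.2 hne.symm) 2
  set ξ := (cay x z).im
  set ξ' := (cay (onCircle g⁻¹ x) (onCircle g⁻¹ z)).im
  have h4 : lam g z * (1 + ξ' ^ 2) = 1 + ξ ^ 2 := by
    apply mul_left_cancel₀ hd.ne'
    linarith
  have h5 : ξ' ^ 2 < ξ ^ 2 := by nlinarith [sq_nonneg ξ']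
  have h6 : ξ' = ξ - tau g x := by linarith
  rw [h6] at h5
  nlinarith [sq_nonneg (tau g x)]

/-- The points at which every partial product `G k` expands step by step. -/
def expandingSet (h G : ℕ → discGroup) (m : ℕ) : Set Circle :=
  {z | ∀ k < m, onCircle (G k)⁻¹ z ∈ expansionInterval (h k)}

lemma center_ne_zero_of_one_lt_lam {g : discGroup} {z : Circle} (h : 1 < lam g z) :
    center g ≠ 0 := fun e => by
  rw [lam_eq, e] at h
  simp [Circle.norm_coe] at h

section Products

variable {h G : ℕ → discGroup} {x : Circle}

lemma center_ne_zero_of_closure (hx : ∀ m, x ∈ closure (expandingSet h G m)) (k : ℕ) :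
    center (h k) ≠ 0 := by
  obtain ⟨z, hz⟩ := closure_nonempty_iff.1 ⟨x, hx (k + 1)⟩
  exact center_ne_zero_of_one_lt_lam ((mem_expansionInterval _ _).1 (hz k k.lt_succ_self))

lemma one_le_lam_of_closure (hx : ∀ m, x ∈ closure (expandingSet h G m)) (k : ℕ) :
    1 ≤ lam (h k) (onCircle (G k)⁻¹ x) := by
  have hcl : IsClosed {z | 1 ≤ lam (h k) (onCircle (G k)⁻¹ z)} :=
    isClosed_le continuous_const ((continuous_lam _).comp (continuous_onCircle _))
  have hsub : expandingSet h G (k + 1) ⊆ {z | 1 ≤ lam (h k) (onCircle (G k)⁻¹ z)} := fun z hz =>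
    ((mem_expansionInterval _ _).1 (hz k k.lt_succ_self)).le
  exact hcl.closure_subset_iff.2 hsub (hx (k + 1))

/-- If all steps are isometric at `x`, then all translation parts have the same sign. -/
lemma tau_mul_tau_pos (hG0 : G 0 = 1) (hx : ∀ m, x ∈ closure (expandingSet h G m))
    (h1 : ∀ k, lam (h k) (onCircle (G k)⁻¹ x) = 1) (hl : ∀ k, lam (G k) x = 1) (k : ℕ) :
    0 < tau (h 0) x * tau (h k) (onCircle (G k)⁻¹ x) := by
  set M := |tau (G k) x|
  have hM : 0 ≤ M := abs_nonneg _
  obtain ⟨z, hz, hzx⟩ := Metric.mem_closure_iff.1 (hx (k + 1)) (1 / (1 + M)) (by positivity)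
  have hz0 := (mem_expansionInterval _ _).1 (hz 0 k.succ_pos)
  have hzk := (mem_expansionInterval _ _).1 (hz k k.lt_succ_self)
  have hx0 := h1 0
  rw [hG0, inv_one, onCircle_one] at hz0 hx0
  have s0 := tau_mul_im_cay_pos hx0 hz0
  have sk := tau_mul_im_cay_pos (h1 k) hzk
  have hne : z ≠ x := fun e => by rw [e, hx0] at hz0; exact lt_irrefl _ hz0
  have e1 := im_cay_eq (hl k) hne
  have e2 := dist_sq_mul_one_add_im_cay_sq hne
  set ξ := (cay x z).im
  set ξ' := (cay (onCircle (G k)⁻¹ x) (onCircle (G k)⁻¹ z)).im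
  -- The radius 1/(1 + M) puts z so near x that its coordinate outweighs the accumulated
  -- translation; ξ and ξ' = ξ - τ(G k) then have the same sign, and both translations inherit it.
  have hbig : M < |ξ| := by
    by_contra! hle
    have h2 : ξ ^ 2 ≤ M ^ 2 := sq_le_sq' (neg_le_of_abs_le hle) (le_of_abs_le hle)
    have h3 : dist x z * (1 + M) < 1 := (lt_div_iff₀ (by positivity)).1 hzx
    have h4 : 0 ≤ dist x z * (1 + M) := by positivity
    have h5 : dist x z ^ 2 * (1 + ξ ^ 2) ≤ (dist x z * (1 + M)) ^ 2 := by
      rw [mul_pow]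
      gcongr
      nlinarith
    nlinarith
  have hT := abs_le.1 (le_refl M)
  have hsame : 0 < ξ * ξ' := by
    rcases lt_abs.1 hbig with hp | hp
    · exact mul_pos (by linarith) (by linarith)
    · exact mul_pos_of_neg_of_neg (by linarith) (by linarith)
  have hpos : 0 < (tau (h 0) x * tau (h k) (onCircle (G k)⁻¹ x)) * (ξ * ξ') := by
    have := mul_pos s0 sk
    linarith
  exact pos_of_mul_pos_left hpos hsame.le

/-- Convergence when all steps are isometric at `x`: the translations add up. -/
lemma tendsto_center_of_isometric (hfin : (range h).Finite) (hG0 : G 0 = 1)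
    (hG : ∀ k, G (k + 1) = G k * h k) (hx : ∀ m, x ∈ closure (expandingSet h G m))
    (h1 : ∀ k, lam (h k) (onCircle (G k)⁻¹ x) = 1) :
    Tendsto (fun k => center (G k)) atTop (𝓝 (x : ℂ)) := by
  have hl : ∀ k, lam (G k) x = 1 := fun k => by
    induction k with
    | zero => rw [hG0, lam_one]
    | succ k ih => rw [hG, lam_mul, ih, h1, one_mul]
  -- There are finitely many factors and none fixes the origin.
  obtain ⟨δ, hδ0, hδ⟩ : ∃ δ > 0, ∀ k, δ ≤ ‖center (h k)‖ := by
    have hev : ∀ᶠ δ in 𝓝[>] (0 : ℝ), ∀ g ∈ range h, δ < ‖center g‖ := by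
      rw [eventually_all_finite hfin]
      rintro _ ⟨k, rfl⟩
      exact nhdsWithin_le_nhds (eventually_lt_nhds
        (norm_pos_iff.2 (center_ne_zero_of_closure hx k)))
    obtain ⟨δ, h1, h2⟩ := (hev.and self_mem_nhdsWithin).exists
    exact ⟨δ, h2, fun k => (h1 _ ⟨k, rfl⟩).le⟩
  have hτ : ∀ k, δ ≤ |tau (h k) (onCircle (G k)⁻¹ x)| := fun k =>
    (hδ k).trans (norm_center_le_abs_tau (h1 k))
  have hpos := tau_mul_tau_pos hG0 hx h1 hl
  have hgrow : ∀ k : ℕ, k * δ ≤ |tau (G k) x| ∧ 0 ≤ tau (h 0) x * tau (G k) x := fun k => by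
    induction k with
    | zero => simp [hG0]
    | succ k ih =>
      rw [hG, tau_mul, hl, one_mul]
      have p := hpos k
      have hk := hτ k
      obtain ⟨i1, i2⟩ := ih
      generalize tau (h k) (onCircle (G k)⁻¹ x) = t at *
      generalize tau (G k) x = T at *
      generalize tau (h 0) x = s at *
      refine ⟨?_, by rw [mul_add]; linarith⟩
      have hadd : |t + T| = |t| + |T| := by
        rw [abs_add_eq_add_abs_iff]
        rcases pos_and_pos_or_neg_and_neg_of_mul_pos p with ⟨a, b⟩ | ⟨a, b⟩
        · exact Or.inl ⟨b.le, by by_contra! hT; nlinarith⟩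
        · exact Or.inr ⟨b.le, by by_contra! hT; nlinarith⟩
      rw [hadd]
      push_cast
      linarith
  refine tendsto_center_of_tendsto_cay (tendsto_atTop_mono (fun k => ?_)
    (tendsto_natCast_atTop_atTop.atTop_mul_const hδ0))
  exact (hgrow k).1.trans (Complex.abs_im_le_norm _)

/-- By compactness, |`lam g` - 1| has a positive minimum on the points at distance at least ε from
the level set, if there are any. -/
lemma exists_lam_eq_one_near (g : discGroup) {ε : ℝ} (hε : 0 < ε) :
    ∃ η > 0, ∀ y, 1 ≤ lam g y → lam g y < 1 + η → ∃ e, lam g e = 1 ∧ dist y e < ε := by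
  set K := {y : Circle | ∀ e, lam g e = 1 → ε ≤ dist y e}
  have hK : IsCompact K := by
    refine IsClosed.isCompact ?_
    simp only [K, ofPred_forall]
    exact isClosed_iInter fun e => isClosed_iInter fun _ =>
      isClosed_le continuous_const (by fun_prop)
  rcases K.eq_empty_or_nonempty with h0 | h0
  · refine ⟨1, one_pos, fun y _ _ => ?_⟩
    have : y ∉ K := by simp [h0]
    simpa [K] using this
  · obtain ⟨y₀, hy₀, hmin⟩ := hK.exists_isMinOn h0
      (f := fun y => |lam g y - 1|) ((continuous_lam g).sub continuous_const).abs.continuousOn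
    refine ⟨|lam g y₀ - 1|, abs_pos.2 (sub_ne_zero.2 fun h => ?_), fun y h1 h2 => ?_⟩
    · have := hy₀ y₀ h
      rw [dist_self] at this
      linarith
    · have : y ∉ K := fun hy => by
        have h3 : |lam g y₀ - 1| ≤ |lam g y - 1| := hmin hy
        rw [abs_of_nonneg (by linarith : 0 ≤ lam g y - 1)] at h3
        linarith
      simpa [K] using this

/-- An orbit along which the expansion tends to one without ever being a contraction is eventually
an orbit of endpoints of expansion intervals. -/
lemma eventually_lam_eq_one {p : ℕ → Circle} (hfin : (range h).Finite)
    (hp : ∀ k, p (k + 1) = onCircle (h k)⁻¹ (p k)) (hc : ∀ k, center (h k) ≠ 0)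
    (h1 : ∀ k, 1 ≤ lam (h k) (p k)) (hlim : Tendsto (fun k => lam (h k) (p k)) atTop (𝓝 1)) :
    ∃ K, ∀ k ≥ K, lam (h k) (p k) = 1 := by
  have hnear : ∀ ε > 0, ∀ᶠ k in atTop, ∃ e, lam (h k) e = 1 ∧ dist (p k) e < ε := fun ε hε => by
    choose η hη0 hη using fun g => exists_lam_eq_one_near g hε
    have hev : ∀ᶠ k in atTop, ∀ g ∈ range h, lam (h k) (p k) < 1 + η g := by
      rw [eventually_all_finite hfin]
      exact fun g _ => hlim.eventually_lt_const (by linarith [hη0 g])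
    filter_upwards [hev] with k hk
    exact hη _ _ (h1 k) (hk _ ⟨k, rfl⟩)
  set E : Set Circle := ⋃ g ∈ range h, {e | lam g e = 1}
  have hE : E.Finite := hfin.biUnion (by
    rintro _ ⟨k, rfl⟩
    exact finite_setOf_lam_eq_one (hc k))
  have hEmem : ∀ k e, lam (h k) e = 1 → e ∈ E := fun k e he =>
    mem_biUnion (mem_range_self k) he
  -- D contains the endpoints and their images after one step, so points of D that are ε-close
  -- coincide.
  set D : Set Circle := E ∪ ⋃ g ∈ range h, onCircle g⁻¹ '' E
  have hD : D.Finite := hE.union (hfin.biUnion fun g _ => hE.image _)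
  obtain ⟨ε, hε0, hε⟩ : ∃ ε > 0, ∀ a ∈ D, ∀ b ∈ D, dist a b < ε → a = b := by
    have hev : ∀ᶠ ε in 𝓝[>] (0 : ℝ), ∀ q ∈ D.offDiag, ε < dist q.1 q.2 := by
      rw [eventually_all_finite hD.offDiag]
      exact fun q hq => nhdsWithin_le_nhds (eventually_lt_nhds (dist_pos.2 hq.2.2))
    obtain ⟨ε, h1, h2⟩ := (hev.and self_mem_nhdsWithin).exists
    refine ⟨ε, h2, fun a ha b hb hab => ?_⟩
    by_contra hne
    exact lt_asymm hab (h1 (a, b) ⟨ha, hb, hne⟩)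
  -- Expansion below 4 at most doubles a distance to an endpoint, since the endpoint itself
  -- contributes the factor 1. The image of e k is thus within 2ε/4 + ε/4 < ε of e (k + 1), and the
  -- two agree.
  obtain ⟨K, hK⟩ := eventually_atTop.1
    ((hnear (ε / 4) (by positivity)).and (hlim.eventually_lt_const (by norm_num : (1 : ℝ) < 4)))
  choose! e he1 he2 using fun k (hk : k ≥ K) => (hK k hk).1
  have hstep : ∀ k ≥ K, dist (p (k + 1)) (onCircle (h k)⁻¹ (e k)) ^ 2 =
      lam (h k) (p k) * dist (p k) (e k) ^ 2 := fun k hk => by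
    rw [hp, dist_onCircle_inv_sq, he1 k hk, mul_one]
  have hnext : ∀ k ≥ K, onCircle (h k)⁻¹ (e k) = e (k + 1) := fun k hk => by
    refine hε _ (Or.inr (mem_biUnion (mem_range_self k) ⟨_, hEmem _ _ (he1 k hk), rfl⟩)) _
      (Or.inl (hEmem _ _ (he1 (k + 1) (by omega)))) ?_
    have h2 : dist (p (k + 1)) (onCircle (h k)⁻¹ (e k)) ≤ 2 * (ε / 4) := by
      apply le_of_sq_le_sq _ (by positivity)
      rw [hstep k hk, mul_pow]
      have := (hK k hk).2
      have := he2 k hk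
      gcongr
      linarith
    have h3 := he2 (k + 1) (by omega)
    have h4 := dist_triangle_left (onCircle (h k)⁻¹ (e k)) (e (k + 1)) (p (k + 1))
    linarith
  have hmono : ∀ k ≥ K, dist (p K) (e K) ≤ dist (p k) (e k) := fun k hk => by
    induction k, hk using Nat.le_induction with
    | base => exact le_rfl
    | succ k hk ih =>
      refine ih.trans (le_of_sq_le_sq ?_ dist_nonneg)
      rw [← hnext k hk, hstep k hk]
      nlinarith [h1 k, sq_nonneg (dist (p k) (e k))]
  -- The distance from the orbit to the endpoints never decreases, yet becomes arbitrarily small;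
  -- hence it is zero from the start.
  have hK0 : p K = e K := by
    rw [← dist_le_zero]
    refine le_of_forall_pos_lt_add fun r hr => ?_
    obtain ⟨k, ⟨e', he', hd⟩, hk⟩ :=
      ((hnear (min r (ε / 4)) (by positivity)).and (eventually_ge_atTop K)).exists
    have : e' = e k := by
      refine hε _ (Or.inl (hEmem _ _ he')) _ (Or.inl (hEmem _ _ (he1 k hk))) ?_
      have := dist_triangle_left e' (e k) (p k)
      have := he2 k hk
      have := hd.trans_le (min_le_right _ _)
      linarith
    rw [this] at hd
    rw [zero_add]
    exact (hmono k hk).trans_lt (hd.trans_le (min_le_left _ _))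
  have hall : ∀ k ≥ K, p k = e k := fun k hk => by
    induction k, hk using Nat.le_induction with
    | base => exact hK0
    | succ k hk ih => rw [hp, ih, hnext k hk]
  exact ⟨K, fun k hk => by rw [hall k hk, he1 k hk]⟩

/-- A product of finitely many different factors converges to every point that is approximated, at
all finite stages, by points at which each step is expanding. -/
theorem tendsto_center_of_mem_closure (hfin : (range h).Finite) (hG0 : G 0 = 1)
    (hG : ∀ k, G (k + 1) = G k * h k) (hx : ∀ m, x ∈ closure (expandingSet h G m)) :
    Tendsto (fun k => center (G k)) atTop (𝓝 (x : ℂ)) := by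
  have h1 := one_le_lam_of_closure hx
  have hrec : ∀ k, lam (G (k + 1)) x = lam (G k) x * lam (h k) (onCircle (G k)⁻¹ x) :=
    fun k => by rw [hG, lam_mul]
  have hmono : Monotone fun k => lam (G k) x := monotone_nat_of_le_succ fun k => by
    rw [hrec]
    exact le_mul_of_one_le_right (lam_pos _ _).le (h1 k)
  rcases tendsto_atTop_of_monotone hmono with hinf | ⟨l, hl⟩
  · exact tendsto_center_of_tendsto_cay (tendsto_atTop_mono
      (fun k => (le_abs_self _).trans (Complex.abs_re_le_norm _)) hinf)
  have hl1 : 1 ≤ l := by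
    have := hmono.ge_of_tendsto hl 0
    rwa [hG0, lam_one] at this
  have hl0 : l ≠ 0 := by linarith
  have hlim : Tendsto (fun k => lam (h k) (onCircle (G k)⁻¹ x)) atTop (𝓝 1) := by
    have h2 := (hl.comp (tendsto_add_atTop_nat 1)).div hl hl0
    rw [div_self hl0] at h2
    refine h2.congr fun k => ?_
    simp only [Function.comp, Pi.div_apply]
    rw [hrec, mul_div_cancel_left₀ _ (lam_pos _ _).ne']
  obtain ⟨K, hK⟩ := eventually_lam_eq_one (p := fun k => onCircle (G k)⁻¹ x) hfin
    (fun k => by rw [hG, _root_.mul_inv_rev, onCircle_mul]) (center_ne_zero_of_closure hx) h1 hlim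
  have hshift : ∀ i z, onCircle ((G K)⁻¹ * G (K + i))⁻¹ (onCircle (G K)⁻¹ z) =
      onCircle (G (K + i))⁻¹ z := fun i z => by
    rw [← onCircle_mul, _root_.mul_inv_rev, inv_inv, mul_inv_cancel_right]
  -- Restart the product at time K, seen from the image of x under the inverse of G K, where all
  -- steps are isometric. Continuity of G K on the closed disc brings the limit back to x.
  have hT : Tendsto (fun i => center ((G K)⁻¹ * G (K + i))) atTop
      (𝓝 (onCircle (G K)⁻¹ x : ℂ)) := by
    refine tendsto_center_of_isometric (h := fun i => h (K + i))
      (hfin.subset (range_comp_subset_range (fun i => K + i) h)) (by simp)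
      (fun i => by rw [← add_assoc, hG, mul_assoc]) (fun m => ?_) fun i => ?_
    · refine map_mem_closure (continuous_onCircle (G K)⁻¹) (hx (K + m)) fun z hz i hi => ?_
      rw [hshift]
      exact hz (K + i) (by omega)
    · rw [hshift]
      exact hK _ (by omega)
  rw [← tendsto_add_atTop_iff_nat K]
  have hcont := continuousOn_mobius (G K) (onCircle (G K)⁻¹ x : ℂ)
    (mem_closedBall_zero_iff.2 (Circle.norm_coe _).le)
  have h3 := hcont.tendsto.comp (tendsto_nhdsWithin_iff.2
    ⟨hT, .of_forall fun i => by simpa using (norm_center_lt _).le⟩)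
  rw [← coe_onCircle, onCircle_onCircle_inv] at h3
  refine h3.congr fun i => ?_
  simp only [Function.comp]
  rw [← center_mul, mul_inv_cancel_left, add_comm]

end Products

/-! ### Words -/

section Factors

variable {A : Type*}

@[simp]
lemma length_factor (w : ℕ → A) (i n : ℕ) : (factor w i n).length = n := by
  simp [factor]

@[simp]
lemma factor_zero (w : ℕ → A) (i : ℕ) : factor w i 0 = [] := by
  simp [factor]

@[simp]
lemma factor_one (w : ℕ → A) (i : ℕ) : factor w i 1 = [w i] := by
  simp [factor]

lemma getElem_factor (w : ℕ → A) (i n k : ℕ) (hk : k < (factor w i n).length) :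
    (factor w i n)[k] = w (i + k) := by
  simp [factor]

lemma factor_add (w : ℕ → A) (i n m : ℕ) :
    factor w i (n + m) = factor w i n ++ factor w (i + n) m := by
  simp [factor, List.ofFn_add, add_assoc]

lemma factor_shift (w : ℕ → A) (j i n : ℕ) :
    factor (fun k => w (k + j)) i n = factor w (i + j) n := by
  simp [factor, add_right_comm]

lemma factor_of_append_eq {w : ℕ → A} {i : ℕ} {u v : List A}
    (h : factor w i (u ++ v).length = u ++ v) :
    factor w i u.length = u ∧ factor w (i + u.length) v.length = v := by
  rw [List.length_append, factor_add] at h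
  exact List.append_inj h (by simp)

lemma language_append_left {S : Set (ℕ → A)} {u v : List A} (h : u ++ v ∈ language S) :
    u ∈ language S := by
  obtain ⟨w, hw, i, h⟩ := h
  exact ⟨w, hw, i, (factor_of_append_eq h).1⟩

lemma factor_mem_language {S : Set (ℕ → A)} {w : ℕ → A} (hw : w ∈ S) (i n : ℕ) :
    factor w i n ∈ language S :=
  ⟨w, hw, i, by simp⟩

lemma factor_of_mem_cylinder {w : ℕ → A} {v : List A} (h : w ∈ cylinder v) :
    factor w 0 v.length = v := h

section Subshift

variable [TopologicalSpace A] {S : Set (ℕ → A)}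

lemma IsSubshift.shift_mem (hS : IsSubshift S) {w : ℕ → A} (hw : w ∈ S) (j : ℕ) :
    (fun i => w (i + j)) ∈ S := by
  induction j with
  | zero => exact hw
  | succ j ih => simpa only [add_right_comm, add_assoc] using hS.2 _ ih

/-- A word all whose prefixes lie in the language of a subshift belongs to the subshift. -/
lemma IsSubshift.mem_of_factor_mem [DiscreteTopology A] (hS : IsSubshift S) {w : ℕ → A}
    (h : ∀ n, factor w 0 n ∈ language S) : w ∈ S := by
  have h' : ∀ n, ∃ w' ∈ S, factor w' 0 n = factor w 0 n := fun n => by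
    obtain ⟨w', hw', i, hi⟩ := h n
    refine ⟨_, hS.shift_mem hw' i, ?_⟩
    rw [factor_shift, zero_add]
    simpa using hi
  choose w' hw' hfac using h'
  refine hS.1.mem_of_tendsto (f := w') (b := atTop) ?_ (.of_forall hw')
  rw [tendsto_pi_nhds]
  intro k
  refine tendsto_const_nhds.congr' ?_
  filter_upwards [eventually_gt_atTop k] with n hn
  have e := List.getElem_of_eq (hfac n) (i := k) (by simpa)
  rw [getElem_factor, getElem_factor, zero_add] at e
  exact e.symm

lemma isOpen_setOf_factor [DiscreteTopology A] (P : List A → Prop) (n : ℕ) :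
    IsOpen {w : ℕ → A | P (factor w 0 n)} := by
  have hc : Continuous fun (w : ℕ → A) (k : Fin n) => w (0 + k) := by fun_prop
  exact (isOpen_discrete {f : Fin n → A | P (List.ofFn f)}).preimage hc

end Subshift

end Factors

/-! ### Refined sets -/

lemma isOpen_openArc (x y : Circle) : IsOpen (openArc x y) := by
  have h : openArc x y = ⋃ t ∈ {t : ℝ | t < 2 * Real.pi ∧ y = x * Circle.exp t},
      (fun z => x * z) '' (Circle.exp '' Ioo 0 t) := by
    ext z
    simp only [openArc, mem_ofPred_eq, mem_iUnion, mem_image, mem_Ioo, exists_prop]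
    constructor
    · rintro ⟨s, t, h0, h1, h2, rfl, h3⟩
      exact ⟨t, ⟨h2, h3⟩, _, ⟨s, ⟨h0, h1⟩, rfl⟩, rfl⟩
    · rintro ⟨t, ⟨h2, h3⟩, _, ⟨s, ⟨h0, h1⟩, rfl⟩, rfl⟩
      exact ⟨s, t, h0, h1, h2, rfl, h3⟩
  rw [h]
  exact isOpen_biUnion fun t _ => isOpenMap_mul_left x _
    (isLocalHomeomorph_circleExp.isOpenMap _ isOpen_Ioo)

lemma IsFiniteUnionOfArcs.isOpen {U : Set Circle} (h : IsFiniteUnionOfArcs U) : IsOpen U := by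
  obtain ⟨P, -, -, rfl⟩ := h
  exact isOpen_biUnion fun p _ => isOpen_openArc _ _

section Refined

variable {A : Type*} (F : A → discGroup) (W : A → Set Circle)

lemma wordMap_append (u v : List A) : wordMap F (u ++ v) = wordMap F u * wordMap F v := by
  simp [wordMap]

lemma mem_refined {u : List A} {x : Circle} :
    x ∈ refined F W u ↔
      ∀ (k : ℕ) (hk : k < u.length), onCircle (wordMap F (u.take k))⁻¹ x ∈ W u[k] := by
  simp only [refined, mem_iInter, mem_image_onCircle]
  exact ⟨fun h k hk => h ⟨k, hk⟩, fun h k => h k k.2⟩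

@[simp]
lemma refined_nil : refined F W [] = univ := by
  ext x
  simp [mem_refined]

lemma mem_refined_append {u v : List A} {x : Circle} :
    x ∈ refined F W (u ++ v) ↔ x ∈ refined F W u ∧ onCircle (wordMap F u)⁻¹ x ∈ refined F W v := by
  simp only [mem_refined]
  constructor
  · intro h
    refine ⟨fun k hk => ?_, fun k hk => ?_⟩
    · have h1 := h k (by rw [List.length_append]; omega)
      rwa [List.getElem_append_left hk, List.take_append_of_le_length hk.le] at h1
    · have h1 := h (u.length + k) (by rw [List.length_append]; omega)
      rw [List.getElem_append_right (by omega), List.take_length_add_append, wordMap_append,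
        _root_.mul_inv_rev, onCircle_mul] at h1
      simpa using h1
  · rintro ⟨h1, h2⟩ k hk
    rcases lt_or_ge k u.length with hlt | hge
    · rw [List.getElem_append_left hlt, List.take_append_of_le_length hlt.le]
      exact h1 k hlt
    · obtain ⟨j, rfl⟩ := Nat.exists_eq_add_of_le hge
      rw [List.getElem_append_right (by omega), List.take_length_add_append, wordMap_append,
        _root_.mul_inv_rev, onCircle_mul]
      have h3 := h2 j (by rw [List.length_append] at hk; omega)
      simpa using h3

lemma refined_append_subset (u v : List A) : refined F W (u ++ v) ⊆ refined F W u := fun _ hx =>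
  ((mem_refined_append F W).1 hx).1

variable {W} in
lemma isOpen_refined (hW : ∀ a, IsOpen (W a)) (u : List A) : IsOpen (refined F W u) := by
  refine isOpen_iInter_of_finite fun k => ?_
  have h : onCircle (wordMap F (u.take k)) '' W (u.get k) =
      onCircle (wordMap F (u.take k))⁻¹ ⁻¹' W (u.get k) :=
    ext fun x => mem_image_onCircle _ _ _
  rw [h]
  exact (hW _).preimage (continuous_onCircle _)

lemma refined_factor_anti (w : ℕ → A) : Antitone fun n => refined F W (factor w 0 n) := by
  intro n m hnm
  obtain ⟨k, rfl⟩ := Nat.exists_eq_add_of_le hnm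
  simp only [factor_add]
  exact refined_append_subset F W _ _

/-- The points that lie in the closures of all refined sets along `w`. -/
def limitSet (w : ℕ → A) : Set Circle :=
  ⋂ n, closure (refined F W (factor w 0 n))

variable (S : Set (ℕ → A))

lemma limitSet_nonempty {w : ℕ → A} (hw : w ∈ intervalShift F W S) :
    (limitSet F W w).Nonempty :=
  IsCompact.nonempty_iInter_of_sequence_nonempty_isCompact_isClosed _
    (fun n => closure_mono (refined_factor_anti F W w n.le_succ))
    (fun n => (hw.2 n).closure) isClosed_closure.isCompact fun _ => isClosed_closure

variable {S}

lemma isSubshift_intervalShift [TopologicalSpace A] [DiscreteTopology A] (hS : IsSubshift S) :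
    IsSubshift (intervalShift F W S) := by
  refine ⟨?_, fun w hw => ⟨hS.2 w hw.1, fun n => ?_⟩⟩
  · have h : intervalShift F W S =
        S ∩ ⋂ n, {w | ¬ (refined F W (factor w 0 n)).Nonempty}ᶜ := by
      ext w
      simp [intervalShift]
    rw [h]
    exact hS.1.inter (isClosed_iInter fun n => (isOpen_setOf_factor
      (fun u => ¬ (refined F W u).Nonempty) n).isClosed_compl)
  · obtain ⟨x, hx⟩ := hw.2 (1 + n)
    rw [factor_add, mem_refined_append] at hx
    rw [factor_shift]
    exact ⟨_, hx.2⟩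

/-- Under compatibility, every point of the closure of `W_v` is in the limit set of a word of the
interval shift with prefix `v`. -/
lemma exists_mem_limitSet [TopologicalSpace A] [DiscreteTopology A] (hS : IsSubshift S)
    (hcomp : Compatible F W S) {v : List A} (hv : v ∈ language S) {x : Circle}
    (hx : x ∈ closure (refined F W v)) :
    ∃ w ∈ cylinder v ∩ intervalShift F W S, x ∈ limitSet F W w := by
  have hnext : ∀ u : {u // u ∈ language S ∧ x ∈ closure (refined F W u)},
      ∃ a, u.1 ++ [a] ∈ language S ∧ x ∈ closure (refined F W (u.1 ++ [a])) := fun u => by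
    have h := u.2.2
    rw [hcomp u.1 u.2.1] at h
    simpa using h
  choose a ha using hnext
  -- Starting from v, compatibility adds one letter at a time while x stays in the closure.
  let s : ℕ → {u // u ∈ language S ∧ x ∈ closure (refined F W u)} :=
    fun n => Nat.rec ⟨v, hv, hx⟩ (fun _ u => ⟨u.1 ++ [a u], ha u⟩) n
  let w : ℕ → A := fun i => if h : i < v.length then v[i] else a (s (i - v.length))
  have hs : ∀ n, factor w 0 (v.length + n) = (s n).1 := fun n => by
    induction n with
    | zero =>
      refine List.ext_getElem (by simp [s]) fun k h1 h2 => ?_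
      rw [getElem_factor]
      have hk : k < v.length := by simpa using h1
      simp [w, s, hk]
    | succ n ih =>
      rw [← add_assoc, factor_add, ih, factor_one]
      have : w (0 + (v.length + n)) = a (s n) := by simp [w]
      rw [this]
  have hw : ∀ n, factor w 0 n ∈ language S ∧ x ∈ closure (refined F W (factor w 0 n)) :=
    fun n => by
    have h := (s n).2
    rw [← hs, add_comm, factor_add] at h
    exact ⟨language_append_left h.1, closure_mono (refined_append_subset F W _ _) h.2⟩
  exact ⟨w, ⟨by simpa [s, cylinder] using hs 0, hS.mem_of_factor_mem fun n => (hw n).1,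
    fun n => closure_nonempty_iff.1 ⟨x, (hw n).2⟩⟩, mem_iInter.2 fun n => (hw n).2⟩

lemma phi_eq {w : ℕ → A} {x : Circle} (h : WordRepresents F w x) : phi F w = x := by
  have hex : ∃ x, WordRepresents F w x := ⟨x, h⟩
  rw [phi, dif_pos hex]
  exact hex.choose_spec.unique h

/-- If every word of the interval shift represents all the points of its limit set, then the
interval shift is a number system in which the cylinders have the expected images. -/
theorem isMobiusNumberSystem_of_wordRepresents [TopologicalSpace A] [DiscreteTopology A]
    (hS : IsSubshift S) (hne : S.Nonempty) (hcomp : Compatible F W S)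
    (hrep : ∀ w ∈ intervalShift F W S, ∀ x ∈ limitSet F W w, WordRepresents F w x) :
    IsMobiusNumberSystem F (intervalShift F W S) ∧
      ∀ v ∈ language S, phi F '' (cylinder v ∩ intervalShift F W S) =
        closure (refined F W v) := by
  have hphi : ∀ w ∈ intervalShift F W S, ∀ x ∈ limitSet F W w, phi F w = x := fun w hw x hx =>
    phi_eq F (hrep w hw x hx)
  have hmem : ∀ w ∈ intervalShift F W S, ∀ n, phi F w ∈ closure (refined F W (factor w 0 n)) :=
    fun w hw n => by
    obtain ⟨x, hx⟩ := limitSet_nonempty F W S hw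
    rw [hphi w hw x hx]
    exact mem_iInter.1 hx n
  have himage : ∀ v ∈ language S, phi F '' (cylinder v ∩ intervalShift F W S) =
      closure (refined F W v) := fun v hv => by
    refine Subset.antisymm ?_ fun x hx => ?_
    · rintro _ ⟨w, ⟨hwv, hw⟩, rfl⟩
      have := hmem w hw v.length
      rwa [factor_of_mem_cylinder hwv] at this
    · obtain ⟨w, hw, hxw⟩ := exists_mem_limitSet F W hS hcomp hv hx
      exact ⟨w, hw, hphi w hw.2 x hxw⟩
  refine ⟨⟨isSubshift_intervalShift F W hS, fun w hw => ?_, ?_, fun w hw => ?_⟩, himage⟩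
  · obtain ⟨x, hx⟩ := limitSet_nonempty F W S hw
    exact ⟨x, hrep w hw x hx⟩
  · obtain ⟨w, hw⟩ := hne
    have h := himage [] (by simpa using factor_mem_language hw 0 0)
    simpa [cylinder] using h
  · intro U hU
    -- The nested compact closures intersect only in the value at w, so one of them lies in U; it
    -- also contains the values at all words of the shift with the same prefix of length n.
    obtain ⟨n, hn⟩ := exists_subset_nhds_of_isCompact'
      (V := fun n => closure (refined F W (factor w 0 n))) (U := U)
      (directed_of_isDirected_le fun n m hnm => closure_mono (refined_factor_anti F W w hnm))
      (fun n => isClosed_closure.isCompact) (fun n => isClosed_closure)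
      fun x hx => by rwa [← hphi w hw x hx]
    have hopen := isOpen_setOf_factor (fun u => u = factor w 0 n) n
    rw [mem_map]
    filter_upwards [nhdsWithin_le_nhds (hopen.mem_nhds rfl), self_mem_nhdsWithin] with w' h1 h2
    have h3 : factor w' 0 n = factor w 0 n := h1
    exact hn (h3 ▸ hmem w' h2 n)

/-! ### Expanding prefixes -/

/-- If every word of the interval shift has a prefix in a finite set of expanding words, then it
represents all points of its limit set. -/
theorem wordRepresents_of_expanding_prefixes [Finite A] [TopologicalSpace A] (hS : IsSubshift S)
    [DiscreteTopology A] {B : Set (List A)} (hB : B.Finite) (hnil : [] ∉ B)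
    (hexp : ∀ b ∈ B, refined F W b ⊆ expansionInterval (wordMap F b))
    (hpre : ∀ w ∈ intervalShift F W S, ∃ b ∈ B, w ∈ cylinder b)
    {w : ℕ → A} (hw : w ∈ intervalShift F W S) {x : Circle} (hx : x ∈ limitSet F W w) :
    WordRepresents F w x := by
  have hT := isSubshift_intervalShift F W hS
  -- By shift invariance a block of B starts at every position; following the blocks from position 0
  -- gives the cut points t k.
  have hblock : ∀ i, ∃ l, factor w i l ∈ B := fun i => by
    obtain ⟨b, hb, hwb⟩ := hpre _ (hT.shift_mem hw i)
    refine ⟨b.length, ?_⟩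
    have h := factor_of_mem_cylinder hwb
    rw [factor_shift, zero_add] at h
    rwa [h]
  choose l hl using hblock
  have hlpos : ∀ i, 0 < l i := fun i => by
    rw [Nat.pos_iff_ne_zero]
    intro h
    have := hl i
    rw [h, factor_zero] at this
    exact hnil this
  let t : ℕ → ℕ := fun k => Nat.rec 0 (fun _ i => i + l i) k
  have ht : ∀ k, t (k + 1) = t k + l (t k) := fun k => rfl
  have htm : StrictMono t := strictMono_nat_of_lt_succ fun k => by
    rw [ht]
    exact Nat.lt_add_of_pos_right (hlpos _)
  set G : ℕ → discGroup := fun k => wordMap F (factor w 0 (t k))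
  set h : ℕ → discGroup := fun k => wordMap F (factor w (t k) (l (t k)))
  have hconv : Tendsto (fun k => center (G k)) atTop (𝓝 (x : ℂ)) := by
    refine tendsto_center_of_mem_closure (h := h)
      ((hB.image (wordMap F)).subset ?_) ?_ (fun k => ?_) fun m => ?_
    · rintro _ ⟨k, rfl⟩
      exact ⟨_, hl (t k), rfl⟩
    · simp [G, t, wordMap]
    · simp only [G, h]
      rw [ht, factor_add, wordMap_append, zero_add]
    · refine closure_mono (fun z hz k hk => ?_) (mem_iInter.1 hx (t m))
      have hz1 : z ∈ refined F W (factor w 0 (t (k + 1))) :=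
        refined_factor_anti F W w (htm.monotone (Nat.succ_le_of_lt hk)) hz
      rw [ht, factor_add, mem_refined_append, zero_add] at hz1
      exact hexp _ (hl (t k)) hz1.2
  obtain ⟨L, hL⟩ := (hB.image List.length).bddAbove
  have hlL : ∀ i, l i ≤ L := fun i => hL ⟨_, hl i, by simp⟩
  -- An incomplete block has length at most L, so only finitely many remainders occur and C bounds
  -- their contribution uniformly.
  obtain ⟨C, hC⟩ := ((List.finite_length_le A L).image
    fun p => ‖center (wordMap F p)‖ / (1 - ‖center (wordMap F p)‖)).bddAbove
  have hκ : ∀ n, ∃ k, t k ≤ n ∧ n < t (k + 1) := fun n => by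
    have hex : ∃ k, n < t (k + 1) := ⟨n, (Nat.lt_succ_self n).trans_le (htm.le_apply)⟩
    refine ⟨Nat.find hex, ?_, Nat.find_spec hex⟩
    rcases hk : Nat.find hex with _ | k
    · exact Nat.zero_le n
    · exact not_lt.1 (Nat.find_min hex (by omega))
  choose κ hκ1 hκ2 using hκ
  have hκlim : Tendsto κ atTop atTop := tendsto_atTop.2 fun b => by
    filter_upwards [eventually_ge_atTop (t b)] with n hn
    by_contra! hlt
    have := htm.monotone (Nat.succ_le_of_lt hlt)
    have := hκ2 n
    simp only [Nat.succ_eq_add_one] at *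
    omega
  refine represents_of_tendsto_center ?_
  rw [tendsto_iff_norm_sub_tendsto_zero]
  have hmajor : Tendsto (fun k => (1 - ‖center (G k)‖ ^ 2) * C + ‖center (G k) - x‖) atTop
      (𝓝 0) := by
    have h1 := (((hconv.norm.pow 2).const_sub 1).mul_const C).add
      (tendsto_iff_norm_sub_tendsto_zero.1 hconv)
    simpa [Circle.norm_coe] using h1
  refine squeeze_zero (fun _ => norm_nonneg _) (fun n => ?_) (hmajor.comp hκlim)
  obtain ⟨j, hj⟩ := Nat.exists_eq_add_of_le (hκ1 n)
  have hjL : j ≤ L := by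
    have h1 := hκ2 n
    rw [ht] at h1
    have h2 := hlL (t (κ n))
    omega
  set p := factor w (0 + t (κ n)) j
  have hcenter : center (wordMap F (factor w 0 n)) = mobius (G (κ n)) (center (wordMap F p)) := by
    rw [← center_mul, ← wordMap_append, ← factor_add, ← hj]
  have hb := norm_mobius_sub_center_le (G (κ n)) (norm_center_lt (wordMap F p))
  have hCp : ‖center (wordMap F p)‖ / (1 - ‖center (wordMap F p)‖) ≤ C :=
    hC ⟨p, by simpa [p] using hjL, rfl⟩
  have hnn : 0 ≤ 1 - ‖center (G (κ n))‖ ^ 2 := by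
    have := norm_center_lt (G (κ n))
    nlinarith [norm_nonneg (center (G (κ n)))]
  rw [hcenter]
  calc ‖mobius (G (κ n)) (center (wordMap F p)) - x‖
      ≤ ‖mobius (G (κ n)) (center (wordMap F p)) - center (G (κ n))‖ + ‖center (G (κ n)) - x‖ :=
        norm_sub_le_norm_sub_add_norm_sub _ _ _
    _ ≤ (1 - ‖center (G (κ n))‖ ^ 2) * C + ‖center (G (κ n)) - x‖ := by
        gcongr
        exact hb.trans (by gcongr)

/-! ### The quantities Q_n -/

lemma Qn_le_lam {n : ℕ} {u : List A} (hu : u ∈ language (intervalShift F W S))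
    (hn : u.length = n) {x : Circle} (hx : x ∈ refined F W u) :
    Qn F W S n ≤ lam (wordMap F u) x := by
  have hnn : ∀ u, 0 ≤ qWord F W u := fun u => Real.sInf_nonneg (by
    rintro _ ⟨y, -, rfl⟩
    exact (derivModulus_pos _ _).le)
  have h1 : Qn F W S n ≤ qWord F W u := by
    -- A real infimum is a lower bound only for sets bounded below; here 0 is a bound because
    -- derivative moduli are positive.
    refine csInf_le ⟨0, ?_⟩ ⟨u, ⟨hn, hu⟩, rfl⟩
    rintro _ ⟨v, -, rfl⟩
    exact hnn v
  refine h1.trans ?_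
  rw [← derivModulus_inv]
  refine csInf_le ⟨0, ?_⟩ ⟨x, subset_closure hx, rfl⟩
  rintro _ ⟨y, -, rfl⟩
  exact (derivModulus_pos _ _).le

/-- The quantitative conditions on `Q_n` yield expanding words of length `n`. -/
lemma refined_subset_expansionInterval (hW : ∀ a, IsOpen (W a)) {n : ℕ}
    (hQ : 1 < Qn F W S n ∨ (Qn F W S n = 1 ∧
      ∀ v ∈ language (intervalShift F W S), v.length = n → ¬ IsRotation (wordMap F v)))
    {u : List A} (hu : u ∈ language (intervalShift F W S)) (hn : u.length = n) :
    refined F W u ⊆ expansionInterval (wordMap F u) := by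
  rcases hQ with hQ | ⟨hQ, hrot⟩
  · exact fun x hx => (mem_expansionInterval _ _).2 (hQ.trans_le (Qn_le_lam F W hu hn hx))
  · exact subset_expansionInterval_of_one_le
      (fun h => hrot u hu hn (isRotation_of_center_eq_zero _ h)) (isOpen_refined F hW u)
      fun x hx => hQ ▸ Qn_le_lam F W hu hn hx

end Refined

end MobiusNumber

end

/-! ### The main theorem -/

theorem mainTheorem4 {A : Type*} [Finite A] [TopologicalSpace A] [DiscreteTopology A]
    (F : A → MobiusNumber.discGroup) (W : A → Set Circle) (S : Set (ℕ → A))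
    (hW : MobiusNumber.IsIntervalAlmostCover W)
    (hS : MobiusNumber.IsSubshift S) (hne : S.Nonempty)
    (hcomp : MobiusNumber.Compatible F W S) :
    (∀ B : Set (List A), B.Finite → [] ∉ B →
      (∀ b ∈ B, MobiusNumber.refined F W b ⊆
        MobiusNumber.expansionInterval (MobiusNumber.wordMap F b)) →
      (∀ w ∈ MobiusNumber.intervalShift F W S, ∃ b ∈ B, w ∈ MobiusNumber.cylinder b) →
      MobiusNumber.IsMobiusNumberSystem F (MobiusNumber.intervalShift F W S) ∧
        ∀ v ∈ MobiusNumber.language S,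
          MobiusNumber.phi F '' (MobiusNumber.cylinder v ∩ MobiusNumber.intervalShift F W S) =
            closure (MobiusNumber.refined F W v)) ∧
    (∀ n : ℕ,
      (1 < MobiusNumber.Qn F W S n ∨
        (MobiusNumber.Qn F W S n = 1 ∧
          ∀ v ∈ MobiusNumber.language (MobiusNumber.intervalShift F W S), v.length = n →
            ¬ MobiusNumber.IsRotation (MobiusNumber.wordMap F v))) →
      MobiusNumber.IsMobiusNumberSystem F (MobiusNumber.intervalShift F W S) ∧
        ∀ v ∈ MobiusNumber.language S,
          MobiusNumber.phi F '' (MobiusNumber.cylinder v ∩ MobiusNumber.intervalShift F W S) =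
            closure (MobiusNumber.refined F W v)) := by
  have main : ∀ B : Set (List A), B.Finite → [] ∉ B →
      (∀ b ∈ B, MobiusNumber.refined F W b ⊆
        MobiusNumber.expansionInterval (MobiusNumber.wordMap F b)) →
      (∀ w ∈ MobiusNumber.intervalShift F W S, ∃ b ∈ B, w ∈ MobiusNumber.cylinder b) →
      MobiusNumber.IsMobiusNumberSystem F (MobiusNumber.intervalShift F W S) ∧
        ∀ v ∈ MobiusNumber.language S,
          MobiusNumber.phi F '' (MobiusNumber.cylinder v ∩ MobiusNumber.intervalShift F W S) =
            closure (MobiusNumber.refined F W v) := fun B hB hnil hexp hpre =>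
    MobiusNumber.isMobiusNumberSystem_of_wordRepresents F W hS hne hcomp fun _ hw _ hx =>
      MobiusNumber.wordRepresents_of_expanding_prefixes F W hS hB hnil hexp hpre hw hx
  refine ⟨main, fun n hQ => ?_⟩
  have hexp : ∀ u ∈ MobiusNumber.language (MobiusNumber.intervalShift F W S), u.length = n →
      MobiusNumber.refined F W u ⊆
        MobiusNumber.expansionInterval (MobiusNumber.wordMap F u) := fun u hu hn =>
    MobiusNumber.refined_subset_expansionInterval F W (fun a => (hW.2 a).isOpen) hQ hu hn
  refine main {u | u.length = n ∧ u ∈ MobiusNumber.language (MobiusNumber.intervalShift F W S)}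
    ((List.finite_length_eq A n).subset fun u hu => hu.1) (fun h => ?_)
    (fun u hu => hexp u hu.2 hu.1)
    fun w hw => ⟨MobiusNumber.factor w 0 n,
      ⟨by simp, MobiusNumber.factor_mem_language hw 0 n⟩, by simp [MobiusNumber.cylinder]⟩
  -- If the empty word were in B, then n = 0 and the identity would have to expand on the whole
  -- circle, whereas its derivative is 1.
  have h1 := hexp [] h.2 h.1
  rw [MobiusNumber.refined_nil] at h1
  have h2 := (MobiusNumber.mem_expansionInterval _ _).1 (h1 (Set.mem_univ (1 : Circle)))
  simp [MobiusNumber.wordMap] at h2
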